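/- Let $\mathfrak g$ be an $N$-dimensional real Lie algebra with basis $e_1,\dots,e_N$ and structure constants $[e_A,e_B]=\sum_C f_{AB}{}^C e_C$, and put $c_A=\sum_B f_{AB}{}^B$. Let $\lambda$ be a formal parameter and let $\mathcal U$ be the algebra of polynomials in a central $\lambda$ and in $\hat z_1,\dots,\hat z_N$ subject to $[\hat z_A,\hat z_B]=\lambda\sum_C f_{AB}{}^C\hat z_C$. Let $Z_A=\sum_B\psi_A{}^B(\zeta)\,z_B$, $z_B=\partial/\partial\zeta^B$, be the corresponding left-invariant vector fields in coordinates $\zeta^A$ on the group that vanish at the identity, where each $\psi_A{}^B$ is a formal power series in $\lambda$ with coefficients polynomial in $\zeta$. That is, $[Z_A,Z_B]=\lambda\sum_C f_{AB}{}^C Z_C$, $\psi_A{}^B(0)=\delta_A^B$, and $\psi_A{}^B=\delta_A^B$ at $\lambda=0$. For $\hat f\in\mathcal U$ let $\Omega(\hat f)$ be the function of $z$ obtained by substituting $\hat z_A\mapsto Z_A$, bringing all $\zeta$'s to the left by means of $z_A\zeta^B=\delta_A^B+\zeta^Bz_A$ (the $\zeta$'s commute with one another, and so do the $z$'s), and then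 setting $\zeta=0$. Let $\mathcal F=C^\infty(\mathbb R^N)[[\lambda]]$ (real-valued functions), with coefficientwise convergence in $C^\infty(\mathbb R^N)$ (uniform convergence of all partial derivatives on compact sets). Let $\hat{\mathcal F}$ be the corresponding completion of $\mathcal U$, for which $\Omega$ is a bijection $\hat{\mathcal F}\to\mathcal F$, with the topology transported from $\mathcal F$ by $\Omega$. For $\hat f\in\hat{\mathcal F}$ put $\int\hat f=\int_{\mathbb R^N}\Omega(\hat f)(z)\,d^Nz\in\mathbb R[[\lambda]]$, taken coefficientwise; this integral exists if every coefficient of $\Omega(\hat f)$ is Lebesgue integrable. Then there is exactly one sequentially continuous map $\hat{\mathcal F}\to\hat{\mathcal F}$, written $\hat g(\hat z)\mapsto\hat g(\hat z+\lambda c)$, which on $\mathcal U$ is the substitution $\lambda\mapsto\lambda$, $\hat z_A\mapsto\hat z_A+\lambda c_A$, and the integral is invariant under it: for every $\hat g\in\hat{\mathcal F}$ for which both integrals exist, $$\int\hat g(\hat z+\lambda c)=\int\hat g(\hat z).$$ Moreover, $\int\hat g(\hat z+\lambda c)$ exists whenever all partial derivatives (including those of order zero) of all coefficients of $\Omega(\hat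 g)$ are integrable. -/

import Mathlib

open scoped ContDiff

noncomputable section

namespace LieStar

/-! ### The algebra generated by the coordinates `ζ^A` and the partials `z_A = ∂/∂ζ^A` -/

/-- Generators: `Sum.inl A` is the coordinate `ζ^A`, `Sum.inr A` is the partial `z_A`. -/
inductive WeylRel (N : ℕ) :
    FreeAlgebra ℝ (Fin N ⊕ Fin N) → FreeAlgebra ℝ (Fin N ⊕ Fin N) → Prop
  | zeta_zeta (A B : Fin N) : WeylRel N
      (FreeAlgebra.ι ℝ (Sum.inl A) * FreeAlgebra.ι ℝ (Sum.inl B))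
      (FreeAlgebra.ι ℝ (Sum.inl B) * FreeAlgebra.ι ℝ (Sum.inl A))
  | z_z (A B : Fin N) : WeylRel N
      (FreeAlgebra.ι ℝ (Sum.inr A) * FreeAlgebra.ι ℝ (Sum.inr B))
      (FreeAlgebra.ι ℝ (Sum.inr B) * FreeAlgebra.ι ℝ (Sum.inr A))
  | z_zeta (A B : Fin N) : WeylRel N
      (FreeAlgebra.ι ℝ (Sum.inr A) * FreeAlgebra.ι ℝ (Sum.inl B))
      ((if A = B then 1 else 0) + FreeAlgebra.ι ℝ (Sum.inl B) * FreeAlgebra.ι ℝ (Sum.inr A))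

/-- The Weyl algebra: `ζ`'s commute, `z`'s commute, and `z_A ζ^B = δ_A^B + ζ^B z_A`. -/
def Weyl (N : ℕ) : Type := RingQuot (WeylRel N)

instance (N : ℕ) : Ring (Weyl N) := RingQuot.instRing (WeylRel N)

instance (N : ℕ) : Algebra ℝ (Weyl N) := RingQuot.instAlgebra (WeylRel N)

/-- The quotient map. -/
def Weyl.mk (N : ℕ) : FreeAlgebra ℝ (Fin N ⊕ Fin N) →ₐ[ℝ] Weyl N :=
  RingQuot.mkAlgHom ℝ (WeylRel N)

def zeta {N : ℕ} (A : Fin N) : Weyl N :=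
  Weyl.mk N (FreeAlgebra.ι ℝ (Sum.inl A))

def zz {N : ℕ} (A : Fin N) : Weyl N :=
  Weyl.mk N (FreeAlgebra.ι ℝ (Sum.inr A))

/-- A polynomial `p(ζ)` as an element of the Weyl algebra. -/
def zetaPoly (N : ℕ) : MvPolynomial (Fin N) ℝ →ₗ[ℝ] Weyl N :=
  (MvPolynomial.basisMonomials (Fin N) ℝ).constr ℝ fun α =>
    ((List.finRange N).map fun A => zeta A ^ α A).prod

/-- A polynomial `q(z)` as an element of the Weyl algebra. -/
def zPoly (N : ℕ) : MvPolynomial (Fin N) ℝ →ₗ[ℝ] Weyl N :=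
  (MvPolynomial.basisMonomials (Fin N) ℝ).constr ℝ fun α =>
    ((List.finRange N).map fun A => zz A ^ α A).prod

/-- `ζ^A` acts by `∂/∂z_A` and `z_A` acts by multiplication by `z_A`. -/
def rightActGen (N : ℕ) :
    FreeAlgebra ℝ (Fin N ⊕ Fin N) →ₐ[ℝ] (Module.End ℝ (MvPolynomial (Fin N) ℝ))ᵐᵒᵖ :=
  FreeAlgebra.lift ℝ fun s => MulOpposite.op (Sum.elim
    (fun A => (MvPolynomial.pderiv A).toLinearMap)
    (fun A => LinearMap.mulLeft ℝ (MvPolynomial.X A)) s)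

theorem rightActGen_rel (N : ℕ) ⦃x y : FreeAlgebra ℝ (Fin N ⊕ Fin N)⦄ (h : WeylRel N x y) :
    rightActGen N x = rightActGen N y := by
  induction h with
  | zeta_zeta A B =>
    simp only [rightActGen, map_mul, FreeAlgebra.lift_ι_apply, Sum.elim_inl]
    apply MulOpposite.unop_injective
    refine LinearMap.ext fun f => ?_
    have h0 : ⁅(MvPolynomial.pderiv A :
          Derivation ℝ (MvPolynomial (Fin N) ℝ) (MvPolynomial (Fin N) ℝ)),
        (MvPolynomial.pderiv B :
          Derivation ℝ (MvPolynomial (Fin N) ℝ) (MvPolynomial (Fin N) ℝ))⁆ = 0 := by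
      refine MvPolynomial.derivation_ext fun i => ?_
      simp [Derivation.commutator_apply, MvPolynomial.pderiv_X, Pi.single_apply, apply_ite]
    have h1 := DFunLike.congr_fun h0 f
    rw [Derivation.commutator_apply] at h1
    exact (sub_eq_zero.mp h1).symm
  | z_z A B =>
    simp only [rightActGen, map_mul, FreeAlgebra.lift_ι_apply, Sum.elim_inr, ← MulOpposite.op_mul]
    congr 1
    refine LinearMap.ext fun f => ?_
    simp [mul_left_comm]
  | z_zeta A B =>
    simp only [rightActGen, map_mul, map_add, FreeAlgebra.lift_ι_apply, Sum.elim_inl, Sum.elim_inr,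
      ← MulOpposite.op_mul]
    apply MulOpposite.unop_injective
    refine LinearMap.ext fun f => ?_
    by_cases h : A = B
    · subst h
      simp [Derivation.leibniz, add_comm]
    · simp [Derivation.leibniz, h, MvPolynomial.pderiv_X_of_ne h]

/-- The right action of the Weyl algebra on polynomials in `z`: `f ◁ z_A = f z_A` and
`f ◁ ζ^A = ∂f/∂z_A`. This is the right module obtained from the Weyl algebra by dividing out
everything that has a `ζ` on its left. -/
def rightAct (N : ℕ) : Weyl N →ₐ[ℝ] (Module.End ℝ (MvPolynomial (Fin N) ℝ))ᵐᵒᵖ :=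
  RingQuot.liftAlgHom ℝ ⟨rightActGen N, rightActGen_rel N⟩

/-- `ω`: bring all `ζ`'s to the left and then set `ζ = 0`; see `omega_normalOrdered`. -/
def omega {N : ℕ} (w : Weyl N) : MvPolynomial (Fin N) ℝ :=
  (rightAct N w).unop 1

theorem rightAct_zeta {N : ℕ} (A : Fin N) (f : MvPolynomial (Fin N) ℝ) :
    (rightAct N (zeta A)).unop f = MvPolynomial.pderiv A f := by
  have h : rightAct N (zeta A) = rightActGen N (FreeAlgebra.ι ℝ (Sum.inl A)) :=
    RingQuot.liftAlgHom_mkAlgHom_apply ℝ (rightActGen N) (rightActGen_rel N) _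
  rw [h]
  simp [rightActGen]

theorem rightAct_zz {N : ℕ} (A : Fin N) (f : MvPolynomial (Fin N) ℝ) :
    (rightAct N (zz A)).unop f = MvPolynomial.X A * f := by
  have h : rightAct N (zz A) = rightActGen N (FreeAlgebra.ι ℝ (Sum.inr A)) :=
    RingQuot.liftAlgHom_mkAlgHom_apply ℝ (rightActGen N) (rightActGen_rel N) _
  rw [h]
  simp [rightActGen]

theorem rightAct_list_zz {N : ℕ} (l : List (Fin N)) (α : Fin N →₀ ℕ)
    (f : MvPolynomial (Fin N) ℝ) :
    (rightAct N (l.map fun A => zz A ^ α A).prod).unop f =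
      (l.map fun A => MvPolynomial.X A ^ α A).prod * f := by
  induction l generalizing f with
  | nil => simp
  | cons A l ih =>
    have hp : ∀ (n : ℕ) (g : MvPolynomial (Fin N) ℝ),
        (rightAct N (zz A ^ n)).unop g = MvPolynomial.X A ^ n * g := by
      intro n
      induction n with
      | zero => simp
      | succ n ihn =>
        intro g
        rw [pow_succ, map_mul, MulOpposite.unop_mul, Module.End.mul_apply, ihn, rightAct_zz,
          pow_succ]
        ring
    rw [List.map_cons, List.prod_cons, map_mul, MulOpposite.unop_mul, Module.End.mul_apply, hp,
      ih, List.map_cons, List.prod_cons]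
    ring

theorem rightAct_zPoly {N : ℕ} (q f : MvPolynomial (Fin N) ℝ) :
    (rightAct N (zPoly N q)).unop f = q * f := by
  induction q using MvPolynomial.induction_on' with
  | monomial α a =>
    have h1 : MvPolynomial.monomial α a = a • MvPolynomial.basisMonomials (Fin N) ℝ α := by
      simp [MvPolynomial.smul_monomial]
    rw [h1, map_smul, zPoly, Module.Basis.constr_basis, map_smul, MulOpposite.unop_smul,
      LinearMap.smul_apply, rightAct_list_zz, smul_mul_assoc]
    congr 2
    rw [MvPolynomial.coe_basisMonomials]
    beta_reduce
    rw [MvPolynomial.monomial_eq, ← List.ofFn_eq_map,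
      List.prod_ofFn, Finsupp.prod_fintype _ _ (by simp)]
    simp
  | add p q hp hq => simp [hp, hq, add_mul]

theorem rightAct_list_zeta_one {N : ℕ} (l : List (Fin N)) (α : Fin N →₀ ℕ) :
    (rightAct N (l.map fun A => zeta A ^ α A).prod).unop 1 =
      if ∀ A ∈ l, α A = 0 then 1 else 0 := by
  induction l with
  | nil => simp
  | cons A l ih =>
    rw [List.map_cons, List.prod_cons, map_mul, MulOpposite.unop_mul, Module.End.mul_apply]
    rcases hn : α A with _ | n
    · simp [ih, hn]
    · have h2 : (rightAct N (zeta A ^ (n + 1))).unop 1 = 0 := by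
        rw [pow_succ', map_mul, MulOpposite.unop_mul, Module.End.mul_apply, rightAct_zeta]
        simp
      rw [h2]
      simp [hn]

/-- The rule that defines `ω`: on ordered products `ω(p(ζ) q(z)) = p(0) q(z)`. -/
theorem omega_normalOrdered {N : ℕ} (p q : MvPolynomial (Fin N) ℝ) :
    omega (zetaPoly N p * zPoly N q) = MvPolynomial.C (MvPolynomial.constantCoeff p) * q := by
  rw [omega, map_mul, MulOpposite.unop_mul, Module.End.mul_apply, rightAct_zPoly, mul_comm]
  congr 1
  induction p using MvPolynomial.induction_on' with
  | monomial α a =>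
    have h1 : MvPolynomial.monomial α a = a • MvPolynomial.basisMonomials (Fin N) ℝ α := by
      simp [MvPolynomial.smul_monomial]
    rw [h1, map_smul, zetaPoly, Module.Basis.constr_basis, map_smul, MulOpposite.unop_smul,
      LinearMap.smul_apply, rightAct_list_zeta_one, ← h1, MvPolynomial.constantCoeff_monomial]
    have h2 : (∀ A ∈ List.finRange N, α A = 0) ↔ α = 0 := by
      simp [Finsupp.ext_iff]
    simp only [h2]
    by_cases h : α = 0 <;> simp [h, MvPolynomial.smul_eq_C_mul]
  | add p q hp hq => simp [hp, hq]

/-! ### The quantum space -/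

section QuantumSpace

variable {N : ℕ} {𝔤 : Type*} [LieRing 𝔤] [LieAlgebra ℝ 𝔤]

/-- Structure constants: `[e_A, e_B] = ∑_C f_{AB}^C e_C`. -/
def structureConst (b : Module.Basis (Fin N) ℝ 𝔤) (A B C : Fin N) : ℝ :=
  b.repr ⁅b A, b B⁆ C

/-- `c_A = ∑_B f_{AB}^B`. -/
def cNumber (b : Module.Basis (Fin N) ℝ 𝔤) (A : Fin N) : ℝ :=
  ∑ B, structureConst b A B B

/-- Generators: `none` is the formal parameter `λ`, `some A` is `ẑ_A`. -/
inductive HatRel (b : Module.Basis (Fin N) ℝ 𝔤) :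
    FreeAlgebra ℝ (Option (Fin N)) → FreeAlgebra ℝ (Option (Fin N)) → Prop
  | central (A : Fin N) : HatRel b
      (FreeAlgebra.ι ℝ none * FreeAlgebra.ι ℝ (some A))
      (FreeAlgebra.ι ℝ (some A) * FreeAlgebra.ι ℝ none)
  | comm (A B : Fin N) : HatRel b
      (FreeAlgebra.ι ℝ (some A) * FreeAlgebra.ι ℝ (some B)
        - FreeAlgebra.ι ℝ (some B) * FreeAlgebra.ι ℝ (some A))
      (FreeAlgebra.ι ℝ none * ∑ C, structureConst b A B C • FreeAlgebra.ι ℝ (some C))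

/-- Polynomials in `λ` and the `ẑ_A`: the universal enveloping algebra over `ℝ[λ]` of the Lie
algebra `[ẑ_A, ẑ_B] = λ f_{AB}^C ẑ_C`. -/
def HatPoly (b : Module.Basis (Fin N) ℝ 𝔤) : Type := RingQuot (HatRel b)

instance (b : Module.Basis (Fin N) ℝ 𝔤) : Ring (HatPoly b) := RingQuot.instRing (HatRel b)

instance (b : Module.Basis (Fin N) ℝ 𝔤) : Algebra ℝ (HatPoly b) := RingQuot.instAlgebra (HatRel b)

/-- The quotient map. -/
def HatPoly.mk (b : Module.Basis (Fin N) ℝ 𝔤) :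
    FreeAlgebra ℝ (Option (Fin N)) →ₐ[ℝ] HatPoly b :=
  RingQuot.mkAlgHom ℝ (HatRel b)

theorem HatPoly.mk_rel (b : Module.Basis (Fin N) ℝ 𝔤) {x y : FreeAlgebra ℝ (Option (Fin N))}
    (h : HatRel b x y) : HatPoly.mk b x = HatPoly.mk b y :=
  RingQuot.mkAlgHom_rel ℝ h

def HatPoly.lam (b : Module.Basis (Fin N) ℝ 𝔤) : HatPoly b :=
  HatPoly.mk b (FreeAlgebra.ι ℝ none)

def HatPoly.z (b : Module.Basis (Fin N) ℝ 𝔤) (A : Fin N) : HatPoly b :=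
  HatPoly.mk b (FreeAlgebra.ι ℝ (some A))

theorem HatPoly.lam_mul_z (b : Module.Basis (Fin N) ℝ 𝔤) (A : Fin N) :
    HatPoly.lam b * HatPoly.z b A = HatPoly.z b A * HatPoly.lam b := by
  simpa [HatPoly.lam, HatPoly.z] using HatPoly.mk_rel b (HatRel.central A)

theorem HatPoly.z_comm (b : Module.Basis (Fin N) ℝ 𝔤) (A B : Fin N) :
    HatPoly.z b A * HatPoly.z b B - HatPoly.z b B * HatPoly.z b A =
      HatPoly.lam b * ∑ C, structureConst b A B C • HatPoly.z b C := by
  simpa [HatPoly.lam, HatPoly.z] using HatPoly.mk_rel b (HatRel.comm A B)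

theorem cNumber_eq_trace (b : Module.Basis (Fin N) ℝ 𝔤) (A : Fin N) :
    cNumber b A = LinearMap.trace ℝ 𝔤 (LieAlgebra.ad ℝ 𝔤 (b A)) := by
  rw [LinearMap.trace_eq_matrix_trace ℝ b]
  simp [cNumber, structureConst, Matrix.trace, LinearMap.toMatrix_apply]

/-- `∑_C f_{AB}^C c_C = 0`, so that `ẑ_A ↦ ẑ_A + λ c_A` respects the commutation relations. -/
theorem structureConst_cNumber (b : Module.Basis (Fin N) ℝ 𝔤) (A B : Fin N) :
    ∑ C, structureConst b A B C * cNumber b C = 0 := by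
  have h : ∑ C, structureConst b A B C * cNumber b C =
      LinearMap.trace ℝ 𝔤 (LieAlgebra.ad ℝ 𝔤 ⁅b A, b B⁆) := by
    conv_rhs => rw [← b.sum_repr ⁅b A, b B⁆]
    simp only [cNumber_eq_trace, structureConst, map_sum, map_smul, smul_eq_mul]
  have h2 : LieAlgebra.ad ℝ 𝔤 ⁅b A, b B⁆ =
      LieAlgebra.ad ℝ 𝔤 (b A) * LieAlgebra.ad ℝ 𝔤 (b B) -
        LieAlgebra.ad ℝ 𝔤 (b B) * LieAlgebra.ad ℝ 𝔤 (b A) := by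
    refine LinearMap.ext fun x => ?_
    simp
  rw [h, h2, map_sub, LinearMap.trace_mul_comm, sub_self]

/-- The substitution `λ ↦ λ`, `ẑ_A ↦ ẑ_A + λ c_A`. -/
def hatShift (b : Module.Basis (Fin N) ℝ 𝔤) : HatPoly b →ₐ[ℝ] HatPoly b :=
  RingQuot.liftAlgHom ℝ ⟨FreeAlgebra.lift ℝ (fun s => Option.elim s (HatPoly.lam b)
      (fun A => HatPoly.z b A + cNumber b A • HatPoly.lam b)), by
    intro x y h
    induction h with
    | central A =>
      simp [mul_add, add_mul, HatPoly.lam_mul_z]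
    | comm A B =>
      have h1 := HatPoly.z_comm b A B
      have h2 : HatPoly.lam b * ∑ C, structureConst b A B C •
            (HatPoly.z b C + cNumber b C • HatPoly.lam b) =
          HatPoly.lam b * ∑ C, structureConst b A B C • HatPoly.z b C := by
        simp only [smul_add, smul_smul, Finset.sum_add_distrib, ← Finset.sum_smul,
          structureConst_cNumber, zero_smul, add_zero]
      simp only [map_sub, map_mul, map_sum, map_smul, FreeAlgebra.lift_ι_apply, Option.elim]
      rw [h2, ← h1]
      simp only [mul_add, add_mul, smul_mul_assoc, mul_smul_comm, HatPoly.lam_mul_z,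
        smul_add, smul_comm (cNumber b B) (cNumber b A)]
      abel⟩

/-! ### Left-invariant vector fields in coordinates -/

/-- The differential operator `∑_B ψ^B(ζ) z_B`, where each `ψ^B` is a power series in `λ` whose
coefficients are polynomials in `ζ`. -/
def vectorField (ψ : Fin N → PowerSeries (MvPolynomial (Fin N) ℝ)) : PowerSeries (Weyl N) :=
  PowerSeries.mk fun n => ∑ B, zetaPoly N (PowerSeries.coeff n (ψ B)) * zz B

/-- The left-invariant vector fields `Z_A = ψ_A^B(ζ) z_B` corresponding to the `ẑ_A`, expressed in
coordinates on the group that vanish at the identity: the `Z_A` are a frame with the commutation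
relations `[Z_A, Z_B] = λ f_{AB}^C Z_C`, equal to `∂_A` at the identity and for `λ → 0`. -/
structure LeftInvariantFrame (b : Module.Basis (Fin N) ℝ 𝔤) where
  ψ : Fin N → Fin N → PowerSeries (MvPolynomial (Fin N) ℝ)
  at_identity : ∀ A B, PowerSeries.map MvPolynomial.constantCoeff (ψ A B) =
    if A = B then 1 else 0
  at_lam_zero : ∀ A B, PowerSeries.constantCoeff (ψ A B) = if A = B then 1 else 0
  lie : ∀ A B, vectorField (ψ A) * vectorField (ψ B) - vectorField (ψ B) * vectorField (ψ A) =
    PowerSeries.X * ∑ C, structureConst b A B C • vectorField (ψ C)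

variable {b : Module.Basis (Fin N) ℝ 𝔤}

/-- The substitution `f̂(ẑ) ↦ f̂(Z)`. -/
def substZ (Φ : LeftInvariantFrame b) : HatPoly b →ₐ[ℝ] PowerSeries (Weyl N) :=
  RingQuot.liftAlgHom ℝ ⟨FreeAlgebra.lift ℝ (fun s => Option.elim s PowerSeries.X
      (fun A => vectorField (Φ.ψ A))), by
    intro x y h
    induction h with
    | central A =>
      simp only [map_mul, FreeAlgebra.lift_ι_apply, Option.elim]
      exact PowerSeries.X_mul
    | comm A B =>
      simp only [map_sub, map_mul, map_sum, map_smul, FreeAlgebra.lift_ι_apply, Option.elim]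
      exact Φ.lie A B⟩

/-- `Ω(f̂(ẑ)) = ω(f̂(Z))` on polynomials `f̂`. -/
def OmegaPoly (Φ : LeftInvariantFrame b) (u : HatPoly b) :
    PowerSeries (MvPolynomial (Fin N) ℝ) :=
  PowerSeries.mk fun n => omega (PowerSeries.coeff n (substZ Φ u))

end QuantumSpace

/-! ### Functions on `ℝ^N` -/

/-- The algebra of real `C^∞` functions on `ℝ^N`. -/
def Smooth (N : ℕ) : Subalgebra ℝ ((Fin N → ℝ) → ℝ) where
  carrier := {f | ContDiff ℝ ∞ f}
  mul_mem' {f g} hf hg := by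
    change ContDiff ℝ ∞ fun x => f x * g x
    exact ContDiff.mul (show ContDiff ℝ ∞ f from hf) (show ContDiff ℝ ∞ g from hg)
  add_mem' {f g} hf hg := by
    change ContDiff ℝ ∞ fun x => f x + g x
    exact ContDiff.add (show ContDiff ℝ ∞ f from hf) (show ContDiff ℝ ∞ g from hg)
  algebraMap_mem' r := by
    change ContDiff ℝ ∞ fun _ => r
    exact contDiff_const

/-- The partial derivative `∂f/∂z_A`. -/
def Smooth.partial {N : ℕ} (A : Fin N) (f : Smooth N) : Smooth N :=
  ⟨fun x => fderiv ℝ f.1 x (Pi.single A 1), by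
    have h : ContDiff ℝ ∞ f.1 := f.2
    change ContDiff ℝ ∞ fun x => fderiv ℝ f.1 x (Pi.single A 1)
    exact (h.fderiv_right (m := ∞) (by simp)).clm_apply contDiff_const⟩

/-- Iterated partial derivatives. -/
def Smooth.partials {N : ℕ} (l : List (Fin N)) (f : Smooth N) : Smooth N :=
  l.foldr Smooth.partial f

def Smooth.ofPoly {N : ℕ} (p : MvPolynomial (Fin N) ℝ) : Smooth N :=
  ⟨fun x => MvPolynomial.eval x p, by
    change ContDiff ℝ ∞ fun x => MvPolynomial.eval x p
    induction p using MvPolynomial.induction_on with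
    | C a => simpa using contDiff_const
    | add p q hp hq => simpa using hp.add hq
    | mul_X p i hp => simpa using hp.mul (contDiff_apply ℝ ℝ i)⟩

/-- Convergence in `C^∞(ℝ^N)`: all partial derivatives converge uniformly on compact sets. -/
def Smooth.Converges {N : ℕ} (u : ℕ → Smooth N) (f : Smooth N) : Prop :=
  ∀ (l : List (Fin N)) (K : Set (Fin N → ℝ)), IsCompact K →
    TendstoUniformlyOn (fun m => (Smooth.partials l (u m)).1) (Smooth.partials l f).1
      Filter.atTop K

/-- Formal power series in `λ` with coefficients in `C^∞(ℝ^N)`. -/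
abbrev FunSeries (N : ℕ) : Type := PowerSeries (Smooth N)

/-- Convergence of every coefficient. -/
def FunSeries.Converges {N : ℕ} (u : ℕ → FunSeries N) (f : FunSeries N) : Prop :=
  ∀ n, Smooth.Converges (fun m => PowerSeries.coeff n (u m)) (PowerSeries.coeff n f)

/-! ### The completed quantum algebra and the integral -/

section Hat

variable {N : ℕ} {𝔤 : Type*} [LieRing 𝔤] [LieAlgebra ℝ 𝔤] {b : Module.Basis (Fin N) ℝ 𝔤}

/-- The quantum functions `f̂ = Ω⁻¹(f)`: the completion of the polynomials in `λ` and the `ẑ_A`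
for which `Ω` becomes a bijection onto formal power series in `λ` of `C^∞` functions. An element is
given by its image `f = Ω(f̂)`, and the topology is the one that makes `Ω` a homeomorphism. -/
structure Hat (Φ : LeftInvariantFrame b) where
  Omega : FunSeries N

/-- The inclusion of the polynomials in the completion. -/
def Hat.ofPoly (Φ : LeftInvariantFrame b) (u : HatPoly b) : Hat Φ where
  Omega := PowerSeries.mk fun n => Smooth.ofPoly (PowerSeries.coeff n (OmegaPoly Φ u))

variable {Φ : LeftInvariantFrame b}

def Hat.Converges (u : ℕ → Hat Φ) (f : Hat Φ) : Prop :=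
  FunSeries.Converges (fun m => (u m).Omega) f.Omega

/-- `T` is the map `f̂(ẑ) ↦ f̂(ẑ + λ c)`: the substitution on polynomials, extended by
continuity. -/
structure IsCNumberTranslation (T : Hat Φ → Hat Φ) : Prop where
  on_poly : ∀ u : HatPoly b, T (Hat.ofPoly Φ u) = Hat.ofPoly Φ (hatShift b u)
  continuous : ∀ (u : ℕ → Hat Φ) (f : Hat Φ), Hat.Converges u f →
    Hat.Converges (fun m => T (u m)) (T f)

/-- The integral of `f̂` exists: all coefficients of `f = Ω(f̂)` are Lebesgue integrable. -/
def Hat.IntegralExists (f : Hat Φ) : Prop :=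
  ∀ n, MeasureTheory.Integrable (PowerSeries.coeff n f.Omega).1

/-- The invariant integral `∫ f̂ = ∫ f(z) d^N z`, a formal power series in `λ`. -/
def Hat.integral (f : Hat Φ) : PowerSeries ℝ :=
  PowerSeries.mk fun n => ∫ x, (PowerSeries.coeff n f.Omega).1 x

/-- All partial derivatives of all coefficients of `f = Ω(f̂)` are Lebesgue integrable. -/
def Hat.DerivativesIntegrable (f : Hat Φ) : Prop :=
  ∀ (n : ℕ) (l : List (Fin N)),
    MeasureTheory.Integrable (Smooth.partials l (PowerSeries.coeff n f.Omega)).1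

end Hat

end LieStar

end

/-! The translation by `λ c` is conjugation by the modular function. Let `θ^A` be the coframe dual
to the `Z_A`. Because `c` is the trace of the adjoint representation, it vanishes on brackets, so by
the Maurer–Cartan equation the one-form `c_A θ^A` is closed (`modularForm_closed`). The equation
`Z_A E = λ c_A E` with `E = 1` at the identity can then be solved order by order in `λ`, with
coefficients polynomial in `ζ` (`seriesPDeriv_flatSection`).

As operators, `Z_A E = E (Z_A + λ c_A)`, hence `f̂(Z) E = E f̂(Z + λ c)` for every polynomial `f̂`
(`substZ_mul_modular`). Apply `ω` to both sides. On the right, `E` stands to the left and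
contributes only its value `1` at `ζ = 0`; on the left, each `ζ^A` standing to the right acts as
`∂/∂z_A`. The result is `Ω(f̂(ẑ + λ c)) = E(∂/∂z) Ω(f̂)` (`coeff_OmegaPoly_hatShift`).

Each `λ`-coefficient of the right-hand side is a finite sum of constant coefficient differential
operators applied to coefficients of `Ω(f̂)`. It therefore makes sense on all of the completion and
is continuous there, and it preserves integrability of all derivatives. Uniqueness is density of the
polynomials: they are dense in `C^∞(ℝ^N)`, and `Ω` maps onto polynomial series modulo every power of
`λ`.

For the integral, `E(∂/∂z)` is the identity plus terms with at least one derivative, which ought to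
integrate to zero. Only the total coefficient is assumed integrable, not the separate terms, so both
sides are paired with a cutoff `f(z/R)`. The derivatives are moved onto the cutoff, where each costs
a factor `1/R`, and `R → ∞` (`integral_sum_diffOp`). -/

namespace LieStar

/-! ### Evaluating polynomials at commuting elements of a noncommutative algebra -/

section CommAeval

open scoped IsMulCommutative

variable {σ A : Type*} [Ring A] [Algebra ℝ A]

/-- Evaluation of a polynomial at a commuting family in a possibly noncommutative algebra. -/
noncomputable def commAeval (x : σ → A) (hx : ∀ i j, x i * x j = x j * x i) :
    MvPolynomial σ ℝ →ₐ[ℝ] A :=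
  have := Algebra.isMulCommutative_adjoin ℝ (s := Set.range x) (by
    rintro _ ⟨i, rfl⟩ _ ⟨j, rfl⟩
    exact hx i j)
  (Algebra.adjoin ℝ (Set.range x)).val.comp
    (MvPolynomial.aeval fun i => ⟨x i, Algebra.subset_adjoin ⟨i, rfl⟩⟩)

@[simp]
theorem commAeval_X (x : σ → A) (hx : ∀ i j, x i * x j = x j * x i) (i : σ) :
    commAeval x hx (MvPolynomial.X i) = x i := by
  simp [commAeval]

end CommAeval

/-! ### The Weyl algebra -/

section Weyl

variable {N : ℕ}

theorem zeta_comm (A B : Fin N) : (zeta A * zeta B : Weyl N) = zeta B * zeta A := by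
  have h : Weyl.mk N _ = Weyl.mk N _ := RingQuot.mkAlgHom_rel ℝ (WeylRel.zeta_zeta A B)
  simpa [zeta] using h

theorem zz_mul_zeta (A B : Fin N) :
    (zz A * zeta B : Weyl N) = (if A = B then 1 else 0) + zeta B * zz A := by
  have h : Weyl.mk N _ = Weyl.mk N _ := RingQuot.mkAlgHom_rel ℝ (WeylRel.z_zeta A B)
  simpa [zz, zeta, apply_ite (Weyl.mk N)] using h

/-- The ordered polynomials `p(ζ)` form a commutative subalgebra. -/
noncomputable def zetaHom (N : ℕ) : MvPolynomial (Fin N) ℝ →ₐ[ℝ] Weyl N :=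
  commAeval zeta zeta_comm

theorem basisMonomials_eq_list_prod (α : Fin N →₀ ℕ) :
    MvPolynomial.basisMonomials (Fin N) ℝ α =
      ((List.finRange N).map fun A => MvPolynomial.X A ^ α A).prod := by
  rw [MvPolynomial.coe_basisMonomials]
  beta_reduce
  rw [MvPolynomial.monomial_eq, ← List.ofFn_eq_map, List.prod_ofFn,
    Finsupp.prod_fintype _ _ (by simp)]
  simp

theorem zetaPoly_eq (p : MvPolynomial (Fin N) ℝ) : zetaPoly N p = zetaHom N p := by
  suffices h : zetaPoly N = (zetaHom N).toLinearMap from DFunLike.congr_fun h p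
  refine (MvPolynomial.basisMonomials (Fin N) ℝ).ext fun α => ?_
  rw [zetaPoly, Module.Basis.constr_basis, basisMonomials_eq_list_prod, AlgHom.toLinearMap_apply,
    map_list_prod, List.map_map]
  simp [zetaHom, Function.comp_def]

/-- The Leibniz rule inside the Weyl algebra, obtained from the generator relation by multiplying in
one `ζ` at a time. -/
theorem zz_mul_zetaHom (B : Fin N) (p : MvPolynomial (Fin N) ℝ) :
    zz B * zetaHom N p = zetaHom N (MvPolynomial.pderiv B p) + zetaHom N p * zz B := by
  induction p using MvPolynomial.induction_on with
  | C a =>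
    rw [MvPolynomial.pderiv_C, map_zero, zero_add, ← MvPolynomial.algebraMap_eq,
      AlgHom.commutes, Algebra.commutes]
  | add p q hp hq => simp only [map_add, mul_add, add_mul, hp, hq]; abel
  | mul_X p A hp =>
    rw [map_mul, ← mul_assoc, hp, Derivation.leibniz, add_mul, mul_assoc, mul_assoc]
    have hX : zetaHom N (MvPolynomial.X A) = zeta A := commAeval_X _ _ A
    rw [hX, zz_mul_zeta, mul_add, MvPolynomial.pderiv_X, map_add, smul_eq_mul, smul_eq_mul,
      map_mul, map_mul, hX]
    have hc : zetaHom N p * zeta A = zeta A * zetaHom N p := by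
      rw [← hX, ← map_mul, ← map_mul, mul_comm]
    have hc' : zeta A * zetaHom N (MvPolynomial.pderiv B p) =
        zetaHom N (MvPolynomial.pderiv B p) * zeta A := by
      rw [← hX, ← map_mul, ← map_mul, mul_comm]
    rw [hc']
    by_cases h : B = A
    · subst h; simp; abel
    · rw [Pi.single_eq_of_ne (Ne.symm h), if_neg h]; simp

theorem omega_zPoly (q : MvPolynomial (Fin N) ℝ) : omega (zPoly N q) = q := by
  rw [omega, rightAct_zPoly, mul_one]

theorem omega_zetaHom (p : MvPolynomial (Fin N) ℝ) :
    omega (zetaHom N p) = MvPolynomial.C (MvPolynomial.constantCoeff p) := by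
  rw [omega]
  induction p using MvPolynomial.induction_on with
  | C a =>
    rw [← MvPolynomial.algebraMap_eq, AlgHom.commutes, AlgHom.commutes]
    simp [MvPolynomial.algebraMap_eq, MvPolynomial.smul_eq_C_mul]
  | add p q hp hq => simp [hp, hq]
  | mul_X p A hp =>
    rw [mul_comm, map_mul, map_mul, MulOpposite.unop_mul, Module.End.mul_apply]
    have hX : zetaHom N (MvPolynomial.X A) = zeta A := commAeval_X _ _ A
    rw [hX, rightAct_zeta]
    simp

/-- Partial derivatives are the right action of the `ζ`'s, so their commutation is inherited from
`zeta_comm`. -/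
theorem pderiv_pderiv_comm (A B : Fin N) (f : MvPolynomial (Fin N) ℝ) :
    MvPolynomial.pderiv A (MvPolynomial.pderiv B f) =
      MvPolynomial.pderiv B (MvPolynomial.pderiv A f) := by
  rw [← rightAct_zeta, ← rightAct_zeta, ← rightAct_zeta, ← rightAct_zeta, ← Module.End.mul_apply,
    ← Module.End.mul_apply, ← MulOpposite.unop_mul, ← MulOpposite.unop_mul, ← map_mul, ← map_mul,
    zeta_comm]

/-- `ζ^A` acts by multiplication by `ζ^A` and `z_A` acts by `∂/∂ζ^A`. -/
noncomputable def leftActGen (N : ℕ) :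
    FreeAlgebra ℝ (Fin N ⊕ Fin N) →ₐ[ℝ] Module.End ℝ (MvPolynomial (Fin N) ℝ) :=
  FreeAlgebra.lift ℝ (Sum.elim
    (fun A => LinearMap.mulLeft ℝ (MvPolynomial.X A))
    (fun A => (MvPolynomial.pderiv A).toLinearMap))

theorem leftActGen_rel (N : ℕ) ⦃x y : FreeAlgebra ℝ (Fin N ⊕ Fin N)⦄ (h : WeylRel N x y) :
    leftActGen N x = leftActGen N y := by
  refine LinearMap.ext fun f => ?_
  induction h with
  | zeta_zeta A B => simp [leftActGen, mul_left_comm]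
  | z_z A B => simpa [leftActGen] using pderiv_pderiv_comm A B f
  | z_zeta A B =>
    by_cases h : A = B
    · subst h; simp [leftActGen, Derivation.leibniz, add_comm]
    · simp [leftActGen, Derivation.leibniz, h, MvPolynomial.pderiv_X_of_ne (Ne.symm h)]

/-- The left action of the Weyl algebra on polynomials in `ζ` by differential operators. -/
noncomputable def leftAct (N : ℕ) : Weyl N →ₐ[ℝ] Module.End ℝ (MvPolynomial (Fin N) ℝ) :=
  RingQuot.liftAlgHom ℝ ⟨leftActGen N, leftActGen_rel N⟩

theorem leftAct_zeta (A : Fin N) (f : MvPolynomial (Fin N) ℝ) :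
    leftAct N (zeta A) f = MvPolynomial.X A * f := by
  have h : leftAct N (zeta A) = leftActGen N (FreeAlgebra.ι ℝ (Sum.inl A)) :=
    RingQuot.liftAlgHom_mkAlgHom_apply ℝ (leftActGen N) (leftActGen_rel N) _
  rw [h]
  simp [leftActGen]

theorem leftAct_zz (A : Fin N) (f : MvPolynomial (Fin N) ℝ) :
    leftAct N (zz A) f = MvPolynomial.pderiv A f := by
  have h : leftAct N (zz A) = leftActGen N (FreeAlgebra.ι ℝ (Sum.inr A)) :=
    RingQuot.liftAlgHom_mkAlgHom_apply ℝ (leftActGen N) (leftActGen_rel N) _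
  rw [h]
  simp [leftActGen]

theorem leftAct_zetaHom (p f : MvPolynomial (Fin N) ℝ) : leftAct N (zetaHom N p) f = p * f := by
  induction p using MvPolynomial.induction_on generalizing f with
  | C a =>
    rw [← MvPolynomial.algebraMap_eq, AlgHom.commutes, AlgHom.commutes]
    simp [MvPolynomial.algebraMap_eq, MvPolynomial.smul_eq_C_mul]
  | add p q hp hq => simp [hp, hq, add_mul]
  | mul_X p A hp =>
    have hX : zetaHom N (MvPolynomial.X A) = zeta A := commAeval_X _ _ A
    rw [map_mul, map_mul, Module.End.mul_apply, hp, hX, leftAct_zeta, mul_assoc]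

end Weyl

/-! ### The Poincaré lemma for polynomial one-forms -/

section Poincare

variable {σ : Type*}

/-- The operator that divides the monomials of degree `d` by `d + c`. -/
noncomputable def divDegree (c : ℝ) : MvPolynomial σ ℝ →ₗ[ℝ] MvPolynomial σ ℝ :=
  (MvPolynomial.basisMonomials σ ℝ).constr ℝ fun α =>
    MvPolynomial.monomial α (((α.degree : ℕ) : ℝ) + c)⁻¹

theorem divDegree_monomial (c a : ℝ) (α : σ →₀ ℕ) :
    divDegree c (MvPolynomial.monomial α a) =
      MvPolynomial.monomial α (a * (((α.degree : ℕ) : ℝ) + c)⁻¹) := by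
  have h1 : MvPolynomial.monomial α a = a • MvPolynomial.basisMonomials σ ℝ α := by
    simp [MvPolynomial.smul_monomial]
  rw [h1, map_smul, divDegree, Module.Basis.constr_basis, MvPolynomial.smul_monomial, smul_eq_mul]

/-- A derivative lowers the degree by one, so division by `d` before it becomes division by `(d - 1)
+ 1` after it. Constants cause no trouble, since both sides vanish on them. -/
theorem pderiv_divDegree (i : σ) (p : MvPolynomial σ ℝ) :
    MvPolynomial.pderiv i (divDegree 0 p) = divDegree 1 (MvPolynomial.pderiv i p) := by
  induction p using MvPolynomial.induction_on' with
  | monomial α a =>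
    rw [divDegree_monomial, MvPolynomial.pderiv_monomial, MvPolynomial.pderiv_monomial,
      divDegree_monomial]
    by_cases h : α i = 0
    · simp [h]
    · have h1 : Finsupp.single i 1 ≤ α := by
        rw [Finsupp.single_le_iff]; omega
      have h2 : α.degree = (α - Finsupp.single i 1).degree + 1 := by
        conv_lhs => rw [← tsub_add_cancel_of_le h1]
        simp
      congr 1
      rw [h2]
      push_cast
      ring
  | add p q hp hq => simp [hp, hq]

/-- By Euler's identity the bracket multiplies monomials of degree `d` by `d + 1`, which `divDegree
1` undoes. -/
theorem divDegree_euler [Fintype σ] (p : MvPolynomial σ ℝ) :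
    divDegree 1 (p + ∑ i, MvPolynomial.X i * MvPolynomial.pderiv i p) = p := by
  induction p using MvPolynomial.induction_on' with
  | monomial α a =>
    have h : ∑ i, MvPolynomial.X i * MvPolynomial.pderiv i (MvPolynomial.monomial α a) =
        α.degree • MvPolynomial.monomial α a :=
      (MvPolynomial.isHomogeneous_monomial a rfl).sum_X_mul_pderiv
    rw [h, map_add, map_nsmul, divDegree_monomial, ← map_nsmul, ← map_add]
    congr 1
    have : ((α.degree : ℕ) : ℝ) + 1 ≠ 0 := by positivity
    rw [nsmul_eq_mul]
    field_simp
    ring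
  | add p q hp hq =>
    conv_rhs => rw [← hp, ← hq, ← map_add]
    congr 1
    simp only [map_add, mul_add, Finset.sum_add_distrib]
    abel

/-- In degree `0` the divisor is `0`, and the convention `0⁻¹ = 0` removes the constant term. -/
theorem constantCoeff_divDegree_zero (p : MvPolynomial σ ℝ) :
    MvPolynomial.constantCoeff (divDegree 0 p) = 0 := by
  classical
  induction p using MvPolynomial.induction_on' with
  | monomial α a =>
    rw [divDegree_monomial, MvPolynomial.constantCoeff_monomial]
    by_cases h : α = 0 <;> simp [h]
  | add p q hp hq => simp [hp, hq]

/-- The primitive vanishing at the origin of a polynomial one-form. -/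
noncomputable def primitive [Fintype σ] (a : σ → MvPolynomial σ ℝ) : MvPolynomial σ ℝ :=
  divDegree 0 (∑ j, MvPolynomial.X j * a j)

theorem constantCoeff_primitive [Fintype σ] (a : σ → MvPolynomial σ ℝ) :
    MvPolynomial.constantCoeff (primitive a) = 0 :=
  constantCoeff_divDegree_zero _

/-- A closed polynomial one-form is exact. -/
theorem pderiv_primitive [Fintype σ] (a : σ → MvPolynomial σ ℝ)
    (ha : ∀ i j, MvPolynomial.pderiv i (a j) = MvPolynomial.pderiv j (a i)) (i : σ) :
    MvPolynomial.pderiv i (primitive a) = a i := by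
  classical
  rw [primitive, pderiv_divDegree]
  conv_rhs => rw [← divDegree_euler (a i)]
  congr 1
  -- Closedness replaces `∂_i a_j` by `∂_j a_i`, so that `∂_i (∑ x_j a_j)` becomes `a_i` plus its
  -- Euler derivative.
  simp only [map_sum, Derivation.leibniz, MvPolynomial.pderiv_X, smul_eq_mul,
    Finset.sum_add_distrib, ha i, Pi.single_apply]
  rw [add_comm]
  simp

end Poincare

/-! ### Power series in `λ` with polynomial coefficients -/

section Series

variable {σ : Type*}

/-- Coefficientwise partial derivative. -/
noncomputable def seriesPDeriv (i : σ) :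
    PowerSeries (MvPolynomial σ ℝ) →+ PowerSeries (MvPolynomial σ ℝ) where
  toFun F := PowerSeries.mk fun n => MvPolynomial.pderiv i (PowerSeries.coeff n F)
  map_zero' := by ext1 n; simp
  map_add' F G := by ext1 n; simp

@[simp]
theorem coeff_seriesPDeriv (i : σ) (F : PowerSeries (MvPolynomial σ ℝ)) (n : ℕ) :
    PowerSeries.coeff n (seriesPDeriv i F) = MvPolynomial.pderiv i (PowerSeries.coeff n F) := by
  simp [seriesPDeriv]

theorem seriesPDeriv_mul (i : σ) (F G : PowerSeries (MvPolynomial σ ℝ)) :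
    seriesPDeriv i (F * G) = seriesPDeriv i F * G + F * seriesPDeriv i G := by
  ext1 n
  simp only [coeff_seriesPDeriv, PowerSeries.coeff_mul, map_add, map_sum,
    MvPolynomial.pderiv_mul, Finset.sum_add_distrib]

theorem seriesPDeriv_algebraMap (i : σ) (r : ℝ) :
    seriesPDeriv i (algebraMap ℝ (PowerSeries (MvPolynomial σ ℝ)) r) = 0 := by
  ext1 n
  rw [coeff_seriesPDeriv, PowerSeries.algebraMap_apply, PowerSeries.coeff_C]
  split_ifs <;> simp

variable [Fintype σ]

/-- The coefficients of the normalized solution of `∂_i E = λ a_i E`. -/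
noncomputable def flatCoeff (a : σ → PowerSeries (MvPolynomial σ ℝ)) : ℕ → MvPolynomial σ ℝ
  | 0 => 1
  | n + 1 => primitive fun i =>
      ∑ k : Fin (n + 1), PowerSeries.coeff (n - k) (a i) * flatCoeff a k
  termination_by n => n
  decreasing_by exact k.2

/-- The normalized solution of `∂_i E = λ a_i E`. -/
noncomputable def flatSection (a : σ → PowerSeries (MvPolynomial σ ℝ)) :
    PowerSeries (MvPolynomial σ ℝ) :=
  PowerSeries.mk (flatCoeff a)

theorem coeff_succ_flatSection (a : σ → PowerSeries (MvPolynomial σ ℝ)) (n : ℕ) :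
    PowerSeries.coeff (n + 1) (flatSection a) =
      primitive fun i => PowerSeries.coeff n (a i * flatSection a) := by
  rw [flatSection, PowerSeries.coeff_mk, flatCoeff]
  congr 1
  funext i
  rw [mul_comm, PowerSeries.coeff_mul, Finset.Nat.sum_antidiagonal_eq_sum_range_succ_mk,
    Finset.sum_range]
  simp [mul_comm]

theorem constantCoeff_coeff_flatSection (a : σ → PowerSeries (MvPolynomial σ ℝ)) (n : ℕ) :
    MvPolynomial.constantCoeff (PowerSeries.coeff n (flatSection a)) = if n = 0 then 1 else 0 := by
  rcases n with _ | n
  · simp [flatSection, flatCoeff]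
  · rw [coeff_succ_flatSection, constantCoeff_primitive]
    simp

/-- The coefficient of `λ^(n+1)` is a primitive of the one-form given by the `λ^n` coefficient of
`a_i E`, which must be closed. Indeed `∂_i (a_j E) = (∂_i a_j) E + λ a_i a_j E` is symmetric in `i`
and `j`, and at order `n` this uses the differential equation only for coefficients up to `n`; hence
the strong induction. -/
theorem seriesPDeriv_flatSection (a : σ → PowerSeries (MvPolynomial σ ℝ))
    (ha : ∀ i j, seriesPDeriv i (a j) = seriesPDeriv j (a i)) (i : σ) :
    seriesPDeriv i (flatSection a) = PowerSeries.X * (a i * flatSection a) := by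
  ext1 n
  induction n using Nat.strong_induction_on generalizing i with
  | _ n ih =>
    rcases n with _ | n
    · simp [flatSection, flatCoeff]
    · rw [coeff_seriesPDeriv, PowerSeries.coeff_succ_X_mul, coeff_succ_flatSection,
        pderiv_primitive]
      intro i j
      have h : ∀ i j : σ, PowerSeries.coeff n (a j * seriesPDeriv i (flatSection a)) =
          PowerSeries.coeff n (a j * (PowerSeries.X * (a i * flatSection a))) := by
        intro i j
        rw [PowerSeries.coeff_mul, PowerSeries.coeff_mul]
        refine Finset.sum_congr rfl fun p hp => ?_
        rw [ih p.2 (by have := Finset.HasAntidiagonal.mem_antidiagonal.mp hp; omega) i]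
      have e1 : ∀ i j : σ, MvPolynomial.pderiv i (PowerSeries.coeff n (a j * flatSection a)) =
          PowerSeries.coeff n (seriesPDeriv i (a j) * flatSection a) +
            PowerSeries.coeff n (a j * (PowerSeries.X * (a i * flatSection a))) := by
        intro i j
        rw [← coeff_seriesPDeriv, seriesPDeriv_mul, map_add, h]
      have e2 : a j * (PowerSeries.X * (a i * flatSection a)) =
          a i * (PowerSeries.X * (a j * flatSection a)) := by
        rw [mul_left_comm, mul_left_comm (a j), ← mul_left_comm (a i)]
      rw [e1 i j, e1 j i, ha i j, e2]

end Series

/-! ### The modular function of a left-invariant frame -/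

section Frame

variable {N : ℕ} {𝔤 : Type*} [LieRing 𝔤] [LieAlgebra ℝ 𝔤] {b : Module.Basis (Fin N) ℝ 𝔤}

theorem coeff_vectorField (ψ : Fin N → PowerSeries (MvPolynomial (Fin N) ℝ)) (n : ℕ) :
    PowerSeries.coeff n (vectorField ψ) = ∑ B, zetaHom N (PowerSeries.coeff n (ψ B)) * zz B := by
  simp [vectorField, zetaPoly_eq]

theorem leftAct_coeff_vectorField (ψ : Fin N → PowerSeries (MvPolynomial (Fin N) ℝ)) (n : ℕ)
    (f : MvPolynomial (Fin N) ℝ) :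
    leftAct N (PowerSeries.coeff n (vectorField ψ)) f =
      ∑ B, PowerSeries.coeff n (ψ B) * MvPolynomial.pderiv B f := by
  simp [coeff_vectorField, leftAct_zetaHom, leftAct_zz]

/-- Applying a vector field to a coordinate function recovers its component. This turns the operator
identity `lie` into an identity between the `ψ_A^B`. -/
theorem leftAct_coeff_vectorField_X (ψ : Fin N → PowerSeries (MvPolynomial (Fin N) ℝ)) (n : ℕ)
    (D : Fin N) :
    leftAct N (PowerSeries.coeff n (vectorField ψ)) (MvPolynomial.X D) =
      PowerSeries.coeff n (ψ D) := by
  rw [leftAct_coeff_vectorField, Finset.sum_eq_single D]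
  · simp
  · intro B _ hB
    simp [MvPolynomial.pderiv_X_of_ne (Ne.symm hB)]
  · simp

theorem leftAct_coeff_vectorField_mul_X
    (ψ χ : Fin N → PowerSeries (MvPolynomial (Fin N) ℝ)) (n : ℕ) (D : Fin N) :
    leftAct N (PowerSeries.coeff n (vectorField ψ * vectorField χ)) (MvPolynomial.X D) =
      PowerSeries.coeff n (∑ E, ψ E * seriesPDeriv E (χ D)) := by
  have h : ∀ E, PowerSeries.coeff n (ψ E * seriesPDeriv E (χ D)) =
      ∑ p ∈ Finset.HasAntidiagonal.antidiagonal n, PowerSeries.coeff p.1 (ψ E) *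
        MvPolynomial.pderiv E (PowerSeries.coeff p.2 (χ D)) := by
    intro E
    simp only [PowerSeries.coeff_mul, coeff_seriesPDeriv]
  rw [map_sum, Finset.sum_congr rfl fun E _ => h E, Finset.sum_comm, PowerSeries.coeff_mul, map_sum,
    LinearMap.sum_apply]
  refine Finset.sum_congr rfl fun p _ => ?_
  rw [map_mul, Module.End.mul_apply, leftAct_coeff_vectorField_X, leftAct_coeff_vectorField]

/-- The commutation relations of the frame in terms of its components. -/
theorem LeftInvariantFrame.lie_components (Φ : LeftInvariantFrame b) (A B D : Fin N) :
    ∑ E, Φ.ψ A E * seriesPDeriv E (Φ.ψ B D) - ∑ E, Φ.ψ B E * seriesPDeriv E (Φ.ψ A D) =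
      PowerSeries.X * ∑ C, structureConst b A B C • Φ.ψ C D := by
  ext1 n
  have h := congrArg (fun W => leftAct N (PowerSeries.coeff n W) (MvPolynomial.X D)) (Φ.lie A B)
  simp only [map_sub, LinearMap.sub_apply, leftAct_coeff_vectorField_mul_X] at h
  rw [map_sub, h]
  rcases n with _ | n
  · simp
  · simp only [PowerSeries.coeff_succ_X_mul, map_sum, PowerSeries.coeff_smul, map_smul,
      LinearMap.sum_apply, LinearMap.smul_apply, leftAct_coeff_vectorField_X]

/-- The matrix `ψ_A^B`. -/
noncomputable def LeftInvariantFrame.matrix (Φ : LeftInvariantFrame b) :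
    Matrix (Fin N) (Fin N) (PowerSeries (MvPolynomial (Fin N) ℝ)) :=
  Matrix.of Φ.ψ

theorem LeftInvariantFrame.isUnit_det (Φ : LeftInvariantFrame b) : IsUnit Φ.matrix.det := by
  rw [PowerSeries.isUnit_iff_constantCoeff, RingHom.map_det]
  have h : (PowerSeries.constantCoeff (R := MvPolynomial (Fin N) ℝ)).mapMatrix Φ.matrix = 1 := by
    ext1 A B
    rw [RingHom.mapMatrix_apply, Matrix.map_apply, Matrix.one_apply]
    exact Φ.at_lam_zero A B
  rw [h, Matrix.det_one]
  exact isUnit_one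

/-- The components of the one-form `c_A θ^A`, where `θ^A` is the coframe dual to `Z_A`. -/
noncomputable def LeftInvariantFrame.modularForm (Φ : LeftInvariantFrame b) :
    Fin N → PowerSeries (MvPolynomial (Fin N) ℝ) :=
  Matrix.mulVec Φ.matrix⁻¹ fun A => algebraMap ℝ _ (cNumber b A)

theorem LeftInvariantFrame.sum_mul_modularForm (Φ : LeftInvariantFrame b) (A : Fin N) :
    ∑ B, Φ.ψ A B * Φ.modularForm B = algebraMap ℝ _ (cNumber b A) := by
  have h : Matrix.mulVec Φ.matrix Φ.modularForm = fun A => algebraMap ℝ _ (cNumber b A) := by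
    rw [modularForm, Matrix.mulVec_mulVec, Matrix.mul_nonsing_inv _ Φ.isUnit_det,
      Matrix.one_mulVec]
  exact congrFun h A

/-- The one-form `c_A θ^A` is closed, by the Maurer–Cartan equation. -/
theorem LeftInvariantFrame.modularForm_closed (Φ : LeftInvariantFrame b) (D E : Fin N) :
    seriesPDeriv D (Φ.modularForm E) = seriesPDeriv E (Φ.modularForm D) := by
  set a := Φ.modularForm with ha
  -- `W` is the exterior derivative of `a`, evaluated on the frame by `da(Z_A, Z_B) = Z_A(a(Z_B)) -
  -- Z_B(a(Z_A)) - a([Z_A, Z_B])`. The first two terms vanish because `a(Z_B) = c_B` is constant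
  -- (`h1`), the third because it equals `λ f_{AB}^C c_C = 0` up to sign (`h2`).
  let W : Matrix (Fin N) (Fin N) (PowerSeries (MvPolynomial (Fin N) ℝ)) :=
    Matrix.of fun D E => seriesPDeriv D (a E) - seriesPDeriv E (a D)
  have h1 : ∀ A B : Fin N, ∑ E, ∑ D, (Φ.ψ A E * seriesPDeriv E (Φ.ψ B D) * a D +
      Φ.ψ A E * Φ.ψ B D * seriesPDeriv E (a D)) = 0 := by
    intro A B
    refine Finset.sum_eq_zero fun E _ => ?_
    have h := congrArg (fun F => Φ.ψ A E * seriesPDeriv E F) (Φ.sum_mul_modularForm B)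
    simp only [seriesPDeriv_algebraMap, mul_zero, map_sum, seriesPDeriv_mul, Finset.mul_sum] at h
    rw [← h]
    refine Finset.sum_congr rfl fun D _ => ?_
    rw [← ha]
    ring
  have h2 : ∀ A B : Fin N, ∑ D, (∑ E, Φ.ψ A E * seriesPDeriv E (Φ.ψ B D) -
      ∑ E, Φ.ψ B E * seriesPDeriv E (Φ.ψ A D)) * a D = 0 := by
    intro A B
    have h : ∑ C, structureConst b A B C •
        algebraMap ℝ (PowerSeries (MvPolynomial (Fin N) ℝ)) (cNumber b C) = 0 := by
      simp only [Algebra.smul_def, ← map_mul, ← map_sum, structureConst_cNumber, map_zero]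
    simp only [Φ.lie_components, mul_assoc, Finset.sum_mul, ← Finset.mul_sum]
    rw [Finset.sum_comm]
    simp only [smul_mul_assoc, ← Finset.smul_sum, Φ.sum_mul_modularForm, ha, h, mul_zero]
  have hW : Φ.matrix * W * Φ.matrix.transpose = 0 := by
    ext1 A B
    rw [Matrix.zero_apply, ← sub_eq_zero.mpr ((h1 A B).trans (h1 B A).symm), ← add_zero
      ((Φ.matrix * W * Φ.matrix.transpose) A B), ← h2 A B]
    simp only [Matrix.mul_apply, Matrix.transpose_apply, Finset.sum_mul, W, Matrix.of_apply,
      LeftInvariantFrame.matrix, Finset.sum_add_distrib, sub_mul, Finset.sum_sub_distrib, mul_sub]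
    rw [Finset.sum_comm (f := fun E D => Φ.ψ A E * seriesPDeriv E (Φ.ψ B D) * a D),
      Finset.sum_comm (f := fun E D => Φ.ψ B E * seriesPDeriv E (Φ.ψ A D) * a D),
      Finset.sum_comm (f := fun E D => Φ.ψ A E * Φ.ψ B D * seriesPDeriv E (a D))]
    have e1 : ∑ x, ∑ x_1, Φ.ψ A x_1 * seriesPDeriv x_1 (a x) * Φ.ψ B x =
        ∑ y, ∑ x, Φ.ψ A x * Φ.ψ B y * seriesPDeriv x (a y) :=
      Finset.sum_congr rfl fun _ _ => Finset.sum_congr rfl fun _ _ => by ring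
    have e2 : ∑ x, ∑ x_1, Φ.ψ A x_1 * seriesPDeriv x (a x_1) * Φ.ψ B x =
        ∑ x, ∑ x_1, Φ.ψ B x * Φ.ψ A x_1 * seriesPDeriv x (a x_1) :=
      Finset.sum_congr rfl fun _ _ => Finset.sum_congr rfl fun _ _ => by ring
    rw [e1, e2]
    ring
  have hT : IsUnit Φ.matrix.transpose.det := by
    rw [Matrix.det_transpose]
    exact Φ.isUnit_det
  -- The `Z_A` form a frame, so vanishing on all pairs of them suffices.
  have h3 : W = 0 := by
    have h := congrArg (fun M => Φ.matrix⁻¹ * M * Φ.matrix.transpose⁻¹) hW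
    simpa only [Matrix.mul_assoc, Matrix.mul_nonsing_inv _ hT, Matrix.mul_one, Matrix.zero_mul,
      Matrix.mul_zero, Matrix.nonsing_inv_mul_cancel_left _ _ Φ.isUnit_det] using h
  exact sub_eq_zero.mp (congrFun (congrFun h3 D) E)

/-- The modular function: the solution of `Z_A E = λ c_A E` with value `1` at the identity. -/
noncomputable def LeftInvariantFrame.modular (Φ : LeftInvariantFrame b) :
    PowerSeries (MvPolynomial (Fin N) ℝ) :=
  flatSection Φ.modularForm

theorem LeftInvariantFrame.constantCoeff_coeff_modular (Φ : LeftInvariantFrame b) (n : ℕ) :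
    MvPolynomial.constantCoeff (PowerSeries.coeff n Φ.modular) = if n = 0 then 1 else 0 :=
  constantCoeff_coeff_flatSection _ n

theorem LeftInvariantFrame.sum_mul_seriesPDeriv_modular (Φ : LeftInvariantFrame b) (A : Fin N) :
    ∑ B, Φ.ψ A B * seriesPDeriv B Φ.modular = cNumber b A • (PowerSeries.X * Φ.modular) := by
  simp only [modular, seriesPDeriv_flatSection _ Φ.modularForm_closed]
  rw [Algebra.smul_def, ← Φ.sum_mul_modularForm, Finset.sum_mul]
  exact Finset.sum_congr rfl fun _ _ => by ring

/-! ### The shift intertwines with the modular function -/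

/-- The Leibniz rule `Z E = E Z + Z(E)` for a vector field and a multiplication operator. -/
theorem vectorField_mul_map_zetaHom (ψ : Fin N → PowerSeries (MvPolynomial (Fin N) ℝ))
    (E : PowerSeries (MvPolynomial (Fin N) ℝ)) :
    vectorField ψ * PowerSeries.map (zetaHom N).toRingHom E =
      PowerSeries.map (zetaHom N).toRingHom E * vectorField ψ +
        PowerSeries.map (zetaHom N).toRingHom (∑ B, ψ B * seriesPDeriv B E) := by
  have h1 : vectorField ψ = ∑ B, PowerSeries.map (zetaHom N).toRingHom (ψ B) *
      PowerSeries.C (zz B) := by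
    ext1 n
    simp [coeff_vectorField, PowerSeries.coeff_mul_C]
  have h2 : ∀ B : Fin N, PowerSeries.C (zz B) * PowerSeries.map (zetaHom N).toRingHom E =
      PowerSeries.map (zetaHom N).toRingHom (seriesPDeriv B E) +
        PowerSeries.map (zetaHom N).toRingHom E * PowerSeries.C (zz B) := by
    intro B
    ext1 n
    simp [PowerSeries.coeff_mul_C, PowerSeries.coeff_C_mul, zz_mul_zetaHom]
  rw [h1, Finset.sum_mul, Finset.mul_sum, map_sum, ← Finset.sum_add_distrib]
  refine Finset.sum_congr rfl fun B _ => ?_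
  rw [mul_assoc, h2, mul_add, ← map_mul, ← mul_assoc, ← map_mul, ← mul_assoc, ← map_mul,
    mul_comm E, add_comm]

theorem substZ_lam (Φ : LeftInvariantFrame b) : substZ Φ (HatPoly.lam b) = PowerSeries.X := by
  have h : substZ Φ (HatPoly.mk b (FreeAlgebra.ι ℝ none)) = _ :=
    RingQuot.liftAlgHom_mkAlgHom_apply ℝ _ _ _
  rw [HatPoly.lam, h, FreeAlgebra.lift_ι_apply]
  rfl

theorem substZ_z (Φ : LeftInvariantFrame b) (A : Fin N) :
    substZ Φ (HatPoly.z b A) = vectorField (Φ.ψ A) := by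
  have h : substZ Φ (HatPoly.mk b (FreeAlgebra.ι ℝ (some A))) = _ :=
    RingQuot.liftAlgHom_mkAlgHom_apply ℝ _ _ _
  rw [HatPoly.z, h, FreeAlgebra.lift_ι_apply]
  rfl

theorem hatShift_lam : hatShift b (HatPoly.lam b) = HatPoly.lam b := by
  have h : hatShift b (HatPoly.mk b (FreeAlgebra.ι ℝ none)) = _ :=
    RingQuot.liftAlgHom_mkAlgHom_apply ℝ _ _ _
  conv_lhs => rw [HatPoly.lam, h, FreeAlgebra.lift_ι_apply]
  rfl

theorem hatShift_z (A : Fin N) :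
    hatShift b (HatPoly.z b A) = HatPoly.z b A + cNumber b A • HatPoly.lam b := by
  have h : hatShift b (HatPoly.mk b (FreeAlgebra.ι ℝ (some A))) = _ :=
    RingQuot.liftAlgHom_mkAlgHom_apply ℝ _ _ _
  conv_lhs => rw [HatPoly.z, h, FreeAlgebra.lift_ι_apply]
  rfl

theorem HatPoly.induction {P : HatPoly b → Prop} (hr : ∀ r, P (algebraMap ℝ _ r))
    (hlam : P (HatPoly.lam b)) (hz : ∀ A, P (HatPoly.z b A))
    (hadd : ∀ u v, P u → P v → P (u + v)) (hmul : ∀ u v, P u → P v → P (u * v))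
    (u : HatPoly b) : P u := by
  obtain ⟨x, rfl⟩ : ∃ x, HatPoly.mk b x = u := RingQuot.mkAlgHom_surjective ℝ (HatRel b) u
  induction x using FreeAlgebra.induction with
  | grade0 r => rw [AlgHom.commutes]; exact hr r
  | grade1 s =>
    rcases s with _ | A
    · exact hlam
    · exact hz A
  | mul x y hx hy => rw [map_mul]; exact hmul _ _ hx hy
  | add x y hx hy => rw [map_add]; exact hadd _ _ hx hy

/-- The set of `u` for which `E` intertwines is closed under sums and products, so the generators
suffice; for `ẑ_A` the Leibniz rule and `Z_A E = λ c_A E` give the shift. -/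
theorem substZ_mul_modular (Φ : LeftInvariantFrame b) (u : HatPoly b) :
    substZ Φ u * PowerSeries.map (zetaHom N).toRingHom Φ.modular =
      PowerSeries.map (zetaHom N).toRingHom Φ.modular * substZ Φ (hatShift b u) := by
  induction u using HatPoly.induction with
  | hr r => rw [AlgHom.commutes, AlgHom.commutes, AlgHom.commutes, Algebra.commutes]
  | hlam => rw [hatShift_lam, substZ_lam]; exact PowerSeries.X_mul
  | hz A =>
    rw [hatShift_z, map_add, map_smul, substZ_lam, substZ_z, vectorField_mul_map_zetaHom,
      Φ.sum_mul_seriesPDeriv_modular, mul_add]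
    congr 1
    ext1 n
    rw [mul_smul_comm]
    rcases n with _ | n <;> simp
  | hadd u v hu hv => simp only [map_add, add_mul, mul_add, hu, hv]
  | hmul u v hu hv => rw [map_mul, map_mul, map_mul, mul_assoc, hv, ← mul_assoc, hu, mul_assoc]

theorem omega_sum {ι : Type*} (s : Finset ι) (w : ι → Weyl N) :
    omega (∑ i ∈ s, w i) = ∑ i ∈ s, omega (w i) :=
  map_sum (AddMonoidHom.mk' (omega (N := N)) fun x y => by
    rw [omega, map_add, MulOpposite.unop_add, LinearMap.add_apply]; rfl) w s

/-- Terms with a `ζ` on the left stay of that form under right multiplication, so only `ω(v)`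
matters. -/
theorem omega_mul (v w : Weyl N) : omega (v * w) = (rightAct N w).unop (omega v) := by
  rw [omega, map_mul, MulOpposite.unop_mul, Module.End.mul_apply]
  rfl

/-- `Ω(f̂(ẑ + λ c)) = E(∂/∂z) Ω(f̂)` on polynomials. -/
theorem coeff_OmegaPoly_hatShift (Φ : LeftInvariantFrame b) (u : HatPoly b) (n : ℕ) :
    PowerSeries.coeff n (OmegaPoly Φ (hatShift b u)) =
      ∑ p ∈ Finset.HasAntidiagonal.antidiagonal n,
        (rightAct N (zetaHom N (PowerSeries.coeff p.2 Φ.modular))).unop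
          (PowerSeries.coeff p.1 (OmegaPoly Φ u)) := by
  have h := congrArg (fun W => omega (PowerSeries.coeff n W)) (substZ_mul_modular Φ u)
  simp only [PowerSeries.coeff_mul, omega_sum, omega_mul, PowerSeries.coeff_map,
    AlgHom.toRingHom_eq_coe, RingHom.coe_coe] at h
  simp only [OmegaPoly, PowerSeries.coeff_mk]
  -- With `E` on the left only `E(0) = 1` survives, and this sits in order `λ^0`.
  rw [h, Finset.sum_eq_single (0, n)]
  · rw [omega_zetaHom, Φ.constantCoeff_coeff_modular, if_pos rfl, map_one]
    rfl
  · rintro ⟨i, j⟩ hp hne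
    have hi : i ≠ 0 := by
      rintro rfl
      simp at hp
      exact hne (by rw [hp])
    rw [omega_zetaHom, Φ.constantCoeff_coeff_modular, if_neg hi, map_zero, map_zero]
  · simp

end Frame

/-! ### Constant coefficient differential operators on smooth functions -/

section DiffOp

variable {N : ℕ}

theorem Smooth.contDiff (f : Smooth N) : ContDiff ℝ ∞ f.1 := f.2

theorem Smooth.differentiable (f : Smooth N) : Differentiable ℝ f.1 :=
  (Smooth.contDiff f).differentiable (by simp)

theorem Smooth.continuous (f : Smooth N) : Continuous f.1 := (Smooth.contDiff f).continuous

/-- The partial derivative as a linear map. -/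
noncomputable def Smooth.partialLin (A : Fin N) : Module.End ℝ (Smooth N) where
  toFun := Smooth.partial A
  map_add' f g := by
    refine Subtype.ext (funext fun x => ?_)
    change fderiv ℝ (f.1 + g.1) x (Pi.single A 1) = _
    rw [fderiv_add (Smooth.differentiable f).differentiableAt (Smooth.differentiable g).differentiableAt]
    rfl
  map_smul' r f := by
    refine Subtype.ext (funext fun x => ?_)
    change fderiv ℝ (r • f.1) x (Pi.single A 1) = _
    rw [fderiv_const_smul (Smooth.differentiable f).differentiableAt]
    rfl

theorem Smooth.partialLin_comm (A B : Fin N) :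
    Smooth.partialLin A * Smooth.partialLin B = Smooth.partialLin B * Smooth.partialLin A := by
  refine LinearMap.ext fun f => Subtype.ext (funext fun x => ?_)
  have hd : DifferentiableAt ℝ (fderiv ℝ f.1) x :=
    ((Smooth.contDiff f).fderiv_right (m := ∞) (by simp)).differentiable (by simp) x
  have h : ∀ C D : Fin N, (Smooth.partial C (Smooth.partial D f)).1 x =
      fderiv ℝ (fderiv ℝ f.1) x (Pi.single C 1) (Pi.single D 1) := by
    intro C D
    change fderiv ℝ (fun y => fderiv ℝ f.1 y (Pi.single D 1)) x (Pi.single C 1) = _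
    rw [fderiv_clm_apply hd (differentiableAt_const _)]
    simp
  change (Smooth.partial A (Smooth.partial B f)).1 x = (Smooth.partial B (Smooth.partial A f)).1 x
  rw [h, h]
  exact ((Smooth.contDiff f).contDiffAt.isSymmSndFDerivAt
    (by simpa using WithTop.coe_le_coe.2 (le_top (a := (2 : ℕ∞))))) _ _

/-- The constant coefficient differential operator `p(∂/∂z)`. -/
noncomputable def diffOp (N : ℕ) : MvPolynomial (Fin N) ℝ →ₐ[ℝ] Module.End ℝ (Smooth N) :=
  commAeval Smooth.partialLin Smooth.partialLin_comm

theorem diffOp_X (A : Fin N) (f : Smooth N) :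
    diffOp N (MvPolynomial.X A) f = Smooth.partial A f := by
  rw [diffOp, commAeval_X]
  rfl

theorem diffOp_C (r : ℝ) (f : Smooth N) : diffOp N (MvPolynomial.C r) f = r • f := by
  rw [← MvPolynomial.algebraMap_eq, AlgHom.commutes, Module.algebraMap_end_apply]

theorem diffOp_mul (p q : MvPolynomial (Fin N) ℝ) (f : Smooth N) :
    diffOp N (p * q) f = diffOp N p (diffOp N q f) := by
  rw [map_mul, Module.End.mul_apply]

theorem diffOp_add (p q : MvPolynomial (Fin N) ℝ) (f : Smooth N) :
    diffOp N (p + q) f = diffOp N p f + diffOp N q f := by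
  rw [map_add, LinearMap.add_apply]

theorem Smooth.partials_eq_diffOp (l : List (Fin N)) (f : Smooth N) :
    Smooth.partials l f = diffOp N (l.map MvPolynomial.X).prod f := by
  induction l with
  | nil => simp [Smooth.partials]
  | cons A l ih =>
    rw [List.map_cons, List.prod_cons, diffOp_mul, ← ih, diffOp_X]
    rfl

theorem Smooth.ofPoly_add (p q : MvPolynomial (Fin N) ℝ) :
    Smooth.ofPoly (p + q) = Smooth.ofPoly p + Smooth.ofPoly q :=
  Subtype.ext (funext fun x => map_add (MvPolynomial.eval x) p q)

theorem Smooth.ofPoly_smul (r : ℝ) (p : MvPolynomial (Fin N) ℝ) :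
    Smooth.ofPoly (r • p) = r • Smooth.ofPoly p :=
  Subtype.ext (funext fun x => MvPolynomial.smul_eval x p r)

theorem Smooth.ofPoly_sum {ι : Type*} (s : Finset ι) (p : ι → MvPolynomial (Fin N) ℝ) :
    Smooth.ofPoly (∑ i ∈ s, p i) = ∑ i ∈ s, Smooth.ofPoly (p i) :=
  map_sum (AddMonoidHom.mk' (Smooth.ofPoly (N := N)) Smooth.ofPoly_add) p s

theorem Smooth.partial_ofPoly (A : Fin N) (p : MvPolynomial (Fin N) ℝ) :
    Smooth.partial A (Smooth.ofPoly p) = Smooth.ofPoly (MvPolynomial.pderiv A p) := by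
  induction p using MvPolynomial.induction_on with
  | C a =>
    refine Subtype.ext (funext fun x => ?_)
    change fderiv ℝ (fun y => MvPolynomial.eval y (MvPolynomial.C a)) x (Pi.single A 1) =
      MvPolynomial.eval x _
    simp
  | add p q hp hq =>
    have h := map_add (Smooth.partialLin A) (Smooth.ofPoly p) (Smooth.ofPoly q)
    rw [Smooth.ofPoly_add, map_add, Smooth.ofPoly_add, ← hp, ← hq]
    exact h
  | mul_X p i hp =>
    refine Subtype.ext (funext fun x => ?_)
    have hp' := congrFun (congrArg Subtype.val hp) x
    change fderiv ℝ (fun y => MvPolynomial.eval y p) x (Pi.single A 1) =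
      MvPolynomial.eval x _ at hp'
    have h1 : (fun y : Fin N → ℝ => MvPolynomial.eval y (p * MvPolynomial.X i)) =
        fun y => MvPolynomial.eval y p * y i := by
      funext y
      simp
    have h2 : HasFDerivAt (fun y : Fin N → ℝ => y i)
        (ContinuousLinearMap.proj (R := ℝ) (φ := fun _ : Fin N => ℝ) i) x := hasFDerivAt_apply i x
    change fderiv ℝ (fun y => MvPolynomial.eval y (p * MvPolynomial.X i)) x (Pi.single A 1) =
      MvPolynomial.eval x _
    have h3 : DifferentiableAt ℝ (fun y => MvPolynomial.eval y p) x :=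
      Smooth.differentiable (Smooth.ofPoly p) x
    rw [h1, fderiv_fun_mul h3 h2.differentiableAt,
      h2.fderiv, MvPolynomial.pderiv_mul]
    simp only [add_apply, smul_apply,
      ContinuousLinearMap.proj_apply, hp', map_add, map_mul, MvPolynomial.eval_X, smul_eq_mul,
      MvPolynomial.pderiv_X]
    by_cases h : A = i
    · subst h; simp; ring
    · simp [Pi.single_eq_of_ne (Ne.symm h)]; ring

/-- Identifies the algebraic right action of `p(ζ)` with the analytic operator `p(∂/∂z)`, which is
what allows the extension beyond polynomials. -/
theorem diffOp_ofPoly (p q : MvPolynomial (Fin N) ℝ) :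
    diffOp N p (Smooth.ofPoly q) = Smooth.ofPoly ((rightAct N (zetaHom N p)).unop q) := by
  induction p using MvPolynomial.induction_on generalizing q with
  | C a =>
    rw [diffOp_C, ← MvPolynomial.algebraMap_eq, AlgHom.commutes, AlgHom.commutes,
      ← Smooth.ofPoly_smul]
    simp
  | add p q hp hq =>
    rw [diffOp_add, hp, hq, ← Smooth.ofPoly_add, map_add, map_add, MulOpposite.unop_add,
      LinearMap.add_apply]
  | mul_X p A hp =>
    have hX : zetaHom N (MvPolynomial.X A) = zeta A := commAeval_X _ _ A
    rw [diffOp_mul, diffOp_X, Smooth.partial_ofPoly, hp, mul_comm, map_mul, map_mul,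
      MulOpposite.unop_mul, Module.End.mul_apply, hX, rightAct_zeta]

/-! ### Convergence -/

theorem Smooth.Converges.add {u v : ℕ → Smooth N} {f g : Smooth N} (hu : Smooth.Converges u f)
    (hv : Smooth.Converges v g) : Smooth.Converges (fun m => u m + v m) (f + g) := by
  intro l K hK
  have h := (hu l K hK).add (hv l K hK)
  simp only [Smooth.partials_eq_diffOp, map_add] at h ⊢
  exact h

theorem Smooth.Converges.const_smul {u : ℕ → Smooth N} {f : Smooth N} (r : ℝ)
    (hu : Smooth.Converges u f) : Smooth.Converges (fun m => r • u m) (r • f) := by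
  intro l K hK
  have h := (uniformContinuous_const_smul r).comp_tendstoUniformlyOn (hu l K hK)
  simp only [Smooth.partials_eq_diffOp, map_smul] at h ⊢
  exact h

theorem Smooth.Converges.partial {u : ℕ → Smooth N} {f : Smooth N} (A : Fin N)
    (hu : Smooth.Converges u f) :
    Smooth.Converges (fun m => Smooth.partial A (u m)) (Smooth.partial A f) := by
  intro l K hK
  -- `partials` is a right fold, so the last entry of the list differentiates first.
  simpa [Smooth.partials] using hu (l ++ [A]) K hK

theorem Smooth.Converges.diffOp {u : ℕ → Smooth N} {f : Smooth N} (p : MvPolynomial (Fin N) ℝ)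
    (hu : Smooth.Converges u f) :
    Smooth.Converges (fun m => diffOp N p (u m)) (diffOp N p f) := by
  induction p using MvPolynomial.induction_on generalizing u f with
  | C a => simpa only [diffOp_C] using hu.const_smul a
  | add p q hp hq => simpa only [diffOp_add] using (hp hu).add (hq hu)
  | mul_X p A hp => simpa only [diffOp_mul, diffOp_X] using hp (hu.partial A)

theorem Smooth.Converges.sum {ι : Type*} (s : Finset ι) {u : ι → ℕ → Smooth N} {f : ι → Smooth N}
    (hu : ∀ i ∈ s, Smooth.Converges (u i) (f i)) :
    Smooth.Converges (fun m => ∑ i ∈ s, u i m) (∑ i ∈ s, f i) := by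
  classical
  induction s using Finset.induction_on with
  | empty =>
    intro l K _
    simp only [Finset.sum_empty]
    exact fun v hv => Filter.Eventually.of_forall fun _ _ _ => refl_mem_uniformity hv
  | insert a s ha ih =>
    simp only [Finset.sum_insert ha]
    exact (hu a (Finset.mem_insert_self a s)).add
      (ih fun i hi => hu i (Finset.mem_insert_of_mem hi))

theorem Smooth.Converges.tendsto {u : ℕ → Smooth N} {f : Smooth N} (hu : Smooth.Converges u f)
    (x : Fin N → ℝ) : Filter.Tendsto (fun m => (u m).1 x) Filter.atTop (nhds (f.1 x)) :=
  (hu [] {x} isCompact_singleton).tendsto_at (Set.mem_singleton x)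

theorem Smooth.Converges.unique {u : ℕ → Smooth N} {f g : Smooth N} (hf : Smooth.Converges u f)
    (hg : Smooth.Converges u g) : f = g :=
  Subtype.ext (funext fun x => tendsto_nhds_unique (hf.tendsto x) (hg.tendsto x))

/-! ### Integrability -/

theorem integrable_diffOp (p : MvPolynomial (Fin N) ℝ) {g : Smooth N}
    (hg : ∀ l, MeasureTheory.Integrable (Smooth.partials l g).1) :
    MeasureTheory.Integrable (diffOp N p g).1 := by
  induction p using MvPolynomial.induction_on generalizing g with
  | C a =>
    rw [diffOp_C]
    exact (hg []).smul a
  | add p q hp hq =>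
    rw [diffOp_add]
    exact (hp hg).add (hq hg)
  | mul_X p A hp =>
    rw [diffOp_mul, diffOp_X]
    exact hp fun l => by simpa [Smooth.partials] using hg (l ++ [A])

theorem Smooth.coe_sum {ι : Type*} (s : Finset ι) (f : ι → Smooth N) :
    (∑ i ∈ s, f i : Smooth N).1 = ∑ i ∈ s, (f i).1 :=
  map_sum (Smooth N).val f s

theorem integrable_coe_sum {ι : Type*} (s : Finset ι) {f : ι → Smooth N}
    (hf : ∀ i ∈ s, MeasureTheory.Integrable (f i).1) :
    MeasureTheory.Integrable (∑ i ∈ s, f i : Smooth N).1 := by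
  rw [Smooth.coe_sum]
  exact MeasureTheory.integrable_finsetSum' s hf

theorem hasCompactSupport_diffOp (p : MvPolynomial (Fin N) ℝ) {f : Smooth N}
    (hf : HasCompactSupport f.1) : HasCompactSupport (diffOp N p f).1 := by
  induction p using MvPolynomial.induction_on generalizing f with
  | C a =>
    rw [diffOp_C]
    exact HasCompactSupport.mul_left (f := fun _ => a) hf
  | add p q hp hq =>
    rw [diffOp_add]
    exact (hp hf).add (hq hf)
  | mul_X p A hp =>
    rw [diffOp_mul, diffOp_X]
    exact hp (hf.fderiv_apply ℝ (Pi.single A 1))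

theorem integrable_mul_of_hasCompactSupport (g : Smooth N) {f : Smooth N}
    (hf : HasCompactSupport f.1) : MeasureTheory.Integrable fun x => g.1 x * f.1 x :=
  ((Smooth.continuous g).mul (Smooth.continuous f)).integrable_of_hasCompactSupport hf.mul_left

/-- The formal adjoint `p(-X)` of `p(X)`. -/
noncomputable def adjointPoly : MvPolynomial (Fin N) ℝ →ₐ[ℝ] MvPolynomial (Fin N) ℝ :=
  MvPolynomial.aeval fun i => -MvPolynomial.X i

theorem constantCoeff_adjointPoly (p : MvPolynomial (Fin N) ℝ) :
    MvPolynomial.constantCoeff (adjointPoly p) = MvPolynomial.constantCoeff p := by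
  induction p using MvPolynomial.induction_on with
  | C a => simp [adjointPoly]
  | add p q hp hq => simp only [map_add, hp, hq]
  | mul_X p A hp => simp [adjointPoly]

/-- Integration by parts, one derivative at a time. Compact support of `f` makes every product
integrable, whatever the growth of `g`. -/
theorem integral_diffOp_mul (p : MvPolynomial (Fin N) ℝ) (g : Smooth N) {f : Smooth N}
    (hf : HasCompactSupport f.1) :
    ∫ x, (diffOp N p g).1 x * f.1 x = ∫ x, g.1 x * (diffOp N (adjointPoly p) f).1 x := by
  induction p using MvPolynomial.induction_on generalizing g with
  | C a =>
    have h : adjointPoly (MvPolynomial.C a : MvPolynomial (Fin N) ℝ) = MvPolynomial.C a := by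
      simp [adjointPoly]
    rw [h, diffOp_C, diffOp_C]
    refine MeasureTheory.integral_congr_ae (Filter.Eventually.of_forall fun x => ?_)
    change a * g.1 x * f.1 x = g.1 x * (a * f.1 x)
    ring
  | add p q hp hq =>
    rw [map_add adjointPoly, diffOp_add, diffOp_add]
    have h1 : ∀ x, (diffOp N p g + diffOp N q g).1 x * f.1 x =
        (diffOp N p g).1 x * f.1 x + (diffOp N q g).1 x * f.1 x := fun x => add_mul _ _ _
    have h2 : ∀ x, g.1 x * (diffOp N (adjointPoly p) f + diffOp N (adjointPoly q) f).1 x =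
        g.1 x * (diffOp N (adjointPoly p) f).1 x + g.1 x * (diffOp N (adjointPoly q) f).1 x :=
      fun x => mul_add _ _ _
    simp only [h1, h2]
    rw [MeasureTheory.integral_add (integrable_mul_of_hasCompactSupport _ hf)
        (integrable_mul_of_hasCompactSupport _ hf),
      MeasureTheory.integral_add
        (integrable_mul_of_hasCompactSupport _ (hasCompactSupport_diffOp _ hf))
        (integrable_mul_of_hasCompactSupport _ (hasCompactSupport_diffOp _ hf)), hp, hq]
  | mul_X p A hp =>
    rw [diffOp_mul, diffOp_X, hp]
    set h := diffOp N (adjointPoly p) f with hh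
    have hs : HasCompactSupport h.1 := hasCompactSupport_diffOp _ hf
    have e : diffOp N (adjointPoly (p * MvPolynomial.X A)) f = -Smooth.partial A h := by
      have : adjointPoly (p * MvPolynomial.X A) = -(MvPolynomial.X A * adjointPoly p) := by
        rw [map_mul]
        simp [adjointPoly, mul_comm]
      rw [this, map_neg, LinearMap.neg_apply, diffOp_mul, diffOp_X]
    have hs' : HasCompactSupport (Smooth.partial A h).1 := hs.fderiv_apply ℝ (Pi.single A 1)
    have e2 : ∀ x, g.1 x * (-Smooth.partial A h).1 x = -(g.1 x * (Smooth.partial A h).1 x) :=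
      fun x => mul_neg _ _
    rw [e]
    simp only [e2]
    rw [MeasureTheory.integral_neg]
    have key := integral_mul_fderiv_eq_neg_fderiv_mul_of_integrable (𝕜 := ℝ) (f := g.1) (g := h.1)
      (v := Pi.single A 1) (μ := MeasureTheory.volume)
      (integrable_mul_of_hasCompactSupport (Smooth.partial A g) hs)
      (integrable_mul_of_hasCompactSupport g hs')
      (integrable_mul_of_hasCompactSupport g hs)
      (fun x _ => Smooth.differentiable g x) (fun x _ => Smooth.differentiable h x)
    change _ = -∫ x, g.1 x * fderiv ℝ h.1 x (Pi.single A 1)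
    rw [key, neg_neg]
    rfl

/-! ### Rescaled test functions -/

/-- The function `f(R⁻¹ z)`. -/
noncomputable def Smooth.scale (R : ℝ) (f : Smooth N) : Smooth N :=
  ⟨fun x => f.1 (R⁻¹ • x), (Smooth.contDiff f).comp (contDiff_const_smul R⁻¹)⟩

theorem Smooth.partial_scale (R : ℝ) (A : Fin N) (f : Smooth N) :
    Smooth.partial A (Smooth.scale R f) = R⁻¹ • Smooth.scale R (Smooth.partial A f) := by
  refine Subtype.ext (funext fun x => ?_)
  change fderiv ℝ (fun y => f.1 (R⁻¹ • y)) x (Pi.single A 1) =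
    R⁻¹ * fderiv ℝ f.1 (R⁻¹ • x) (Pi.single A 1)
  rw [fderiv_comp_smul]
  simp

theorem Smooth.hasCompactSupport_scale {R : ℝ} (hR : R ≠ 0) {f : Smooth N}
    (hf : HasCompactSupport f.1) : HasCompactSupport (Smooth.scale R f).1 :=
  hf.comp_smul (inv_ne_zero hR)

/-- Every derivative of `f(R⁻¹ z)` produces a factor `R⁻¹`, so only the constant term of `p`
survives as `R → ∞`, uniformly in `x`. -/
theorem exists_bound_diffOp_scale (p : MvPolynomial (Fin N) ℝ) {f : Smooth N}
    (hf : HasCompactSupport f.1) :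
    ∃ C, ∀ R : ℝ, 1 ≤ R → ∀ x, |(diffOp N p (Smooth.scale R f)).1 x -
      MvPolynomial.constantCoeff p * f.1 (R⁻¹ • x)| ≤ C * R⁻¹ := by
  induction p using MvPolynomial.induction_on generalizing f with
  | C a =>
    refine ⟨0, fun R _ x => ?_⟩
    rw [diffOp_C, MvPolynomial.constantCoeff_C]
    change |a * f.1 (R⁻¹ • x) - _| ≤ _
    simp
  | add p q hp hq =>
    obtain ⟨C, hC⟩ := hp hf
    obtain ⟨D, hD⟩ := hq hf
    refine ⟨C + D, fun R hR x => ?_⟩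
    rw [diffOp_add, map_add, add_mul, add_mul]
    refine le_trans (le_of_eq ?_) ((abs_add_le _ _).trans (add_le_add (hC R hR x) (hD R hR x)))
    congr 1
    exact add_sub_add_comm _ _ _ _
  | mul_X p A hp =>
    have hs : HasCompactSupport (Smooth.partial A f).1 := hf.fderiv_apply ℝ (Pi.single A 1)
    obtain ⟨C, hC⟩ := hp hs
    obtain ⟨M, hM⟩ := (Smooth.continuous (Smooth.partial A f)).bounded_above_of_compact_support hs
    -- One factor `R⁻¹` is already extracted; this constant bounds what remains, with `|C|` for the
    -- inductive error and the second term for the main part.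
    refine ⟨|C| + |MvPolynomial.constantCoeff p| * M, fun R hR x => ?_⟩
    have hR0 : 0 < R⁻¹ := inv_pos.mpr (by linarith)
    have hR1 : R⁻¹ ≤ 1 := inv_le_one_of_one_le₀ hR
    rw [diffOp_mul, diffOp_X, Smooth.partial_scale, map_smul, map_mul,
      MvPolynomial.constantCoeff_X, mul_zero, zero_mul, sub_zero]
    change |R⁻¹ * (diffOp N p (Smooth.scale R (Smooth.partial A f))).1 x| ≤ _
    rw [abs_mul, abs_of_pos hR0, mul_comm]
    refine mul_le_mul_of_nonneg_right ?_ hR0.le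
    have h1 := hC R hR x
    have h2 : |MvPolynomial.constantCoeff p * (Smooth.partial A f).1 (R⁻¹ • x)| ≤
        |MvPolynomial.constantCoeff p| * M := by
      rw [abs_mul]
      exact mul_le_mul_of_nonneg_left (hM _) (abs_nonneg _)
    have h3 : C * R⁻¹ ≤ |C| := by
      calc C * R⁻¹ ≤ |C| * R⁻¹ := mul_le_mul_of_nonneg_right (le_abs_self C) hR0.le
        _ ≤ |C| := mul_le_of_le_one_right (abs_nonneg C) hR1
    have h4 := abs_sub_abs_le_abs_sub ((diffOp N p (Smooth.scale R (Smooth.partial A f))).1 x)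
      (MvPolynomial.constantCoeff p * (Smooth.partial A f).1 (R⁻¹ • x))
    linarith

/-- Dominated convergence with a multiple of `|g|` as majorant; no derivative of `g` has to be
integrable. -/
theorem tendsto_integral_mul_diffOp_scale (p : MvPolynomial (Fin N) ℝ) {f : Smooth N}
    (hf : HasCompactSupport f.1) (h0 : f.1 0 = 1) {g : Smooth N}
    (hg : MeasureTheory.Integrable g.1) :
    Filter.Tendsto
      (fun n : ℕ => ∫ x, g.1 x * (diffOp N p (Smooth.scale ((n : ℝ) + 1) f)).1 x)
      Filter.atTop (nhds (MvPolynomial.constantCoeff p * ∫ x, g.1 x)) := by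
  obtain ⟨C, hC⟩ := exists_bound_diffOp_scale p hf
  obtain ⟨M, hM⟩ := (Smooth.continuous f).bounded_above_of_compact_support hf
  have hinv : Filter.Tendsto (fun n : ℕ => ((n : ℝ) + 1)⁻¹) Filter.atTop (nhds 0) := by
    simpa only [one_div] using tendsto_one_div_add_atTop_nhds_zero_nat (𝕜 := ℝ)
  have h1 : ∀ n : ℕ, (1 : ℝ) ≤ (n : ℝ) + 1 := fun n => by
    have : (0 : ℝ) ≤ n := n.cast_nonneg
    linarith
  rw [← MeasureTheory.integral_const_mul]
  refine MeasureTheory.tendsto_integral_of_dominated_convergence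
    (fun x => ‖g.1 x‖ * (|C| + |MvPolynomial.constantCoeff p| * M)) (fun n => ?_)
    (hg.norm.mul_const _) (fun n => Filter.Eventually.of_forall fun x => ?_)
    (Filter.Eventually.of_forall fun x => ?_)
  · exact ((Smooth.continuous g).mul (Smooth.continuous _)).aestronglyMeasurable
  · rw [norm_mul]
    refine mul_le_mul_of_nonneg_left ?_ (norm_nonneg _)
    have h2 := hC _ (h1 n) x
    have h3 : |MvPolynomial.constantCoeff p * f.1 (((n : ℝ) + 1)⁻¹ • x)| ≤
        |MvPolynomial.constantCoeff p| * M := by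
      rw [abs_mul]
      exact mul_le_mul_of_nonneg_left (hM _) (abs_nonneg _)
    have hR0 : 0 < ((n : ℝ) + 1)⁻¹ := inv_pos.mpr (by linarith [h1 n])
    have h4 : C * ((n : ℝ) + 1)⁻¹ ≤ |C| :=
      (mul_le_mul_of_nonneg_right (le_abs_self C) hR0.le).trans
        (mul_le_of_le_one_right (abs_nonneg C) (inv_le_one_of_one_le₀ (h1 n)))
    have h5 := abs_sub_abs_le_abs_sub ((diffOp N p (Smooth.scale ((n : ℝ) + 1) f)).1 x)
      (MvPolynomial.constantCoeff p * f.1 (((n : ℝ) + 1)⁻¹ • x))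
    rw [Real.norm_eq_abs]
    linarith
  · have h2 : Filter.Tendsto (fun n : ℕ => (diffOp N p (Smooth.scale ((n : ℝ) + 1) f)).1 x -
        MvPolynomial.constantCoeff p * f.1 (((n : ℝ) + 1)⁻¹ • x)) Filter.atTop (nhds 0) :=
      squeeze_zero_norm (fun n => hC _ (h1 n) x) (by simpa using hinv.const_mul C)
    have h3 : Filter.Tendsto (fun n : ℕ => MvPolynomial.constantCoeff p *
        f.1 (((n : ℝ) + 1)⁻¹ • x)) Filter.atTop (nhds (MvPolynomial.constantCoeff p)) := by
      have h4 : Filter.Tendsto (fun n : ℕ => ((n : ℝ) + 1)⁻¹ • x) Filter.atTop (nhds 0) := by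
        simpa using hinv.smul_const x
      have h5 := (((Smooth.continuous f).tendsto 0).comp h4).const_mul (MvPolynomial.constantCoeff p)
      rwa [h0, mul_one] at h5
    have h6 := (h2.add h3).const_mul (g.1 x)
    simp only [sub_add_cancel, zero_add] at h6
    rwa [mul_comm (MvPolynomial.constantCoeff p)]

/-- A smooth cutoff function that is `1` on the ball of radius `r`. -/
theorem exists_cutoff (N : ℕ) (r : ℝ) (hr : 0 < r) :
    ∃ f : Smooth N, HasCompactSupport f.1 ∧ ∀ x, ‖x‖ ≤ r → f.1 x = 1 := by
  let φ : ContDiffBump (0 : Fin N → ℝ) := ⟨r, r + 1, hr, lt_add_one r⟩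
  refine ⟨⟨φ, φ.contDiff⟩, φ.hasCompactSupport, fun x hx => φ.one_of_mem_closedBall ?_⟩
  simpa using hx

/-- The integral is invariant under series of differential operators `E(∂/∂z)` with `E(0) = 1`. -/
theorem integral_sum_diffOp (E : ℕ → MvPolynomial (Fin N) ℝ)
    (hE : ∀ n, MvPolynomial.constantCoeff (E n) = if n = 0 then 1 else 0)
    {g : ℕ → Smooth N} (hg : ∀ n, MeasureTheory.Integrable (g n).1) {n : ℕ} {h : Smooth N}
    (hh : h = ∑ p ∈ Finset.HasAntidiagonal.antidiagonal n, diffOp N (E p.2) (g p.1))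
    (hi : MeasureTheory.Integrable h.1) : ∫ x, h.1 x = ∫ x, (g n).1 x := by
  obtain ⟨f, hf, hf1⟩ := exists_cutoff N 1 one_pos
  have h0 : f.1 0 = 1 := hf1 0 (by simp)
  -- The same pairing with the cutoff has two limits: `l1` uses integrability of the whole sum `h`,
  -- and `l2` that of each `g`, after the operators have moved to the cutoff.
  have l1 := tendsto_integral_mul_diffOp_scale 1 hf h0 hi
  have l2 := tendsto_finsetSum (Finset.HasAntidiagonal.antidiagonal n) fun p _ =>
    tendsto_integral_mul_diffOp_scale (adjointPoly (E p.2)) hf h0 (hg p.1)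
  have e1 : ∀ m : ℕ, ∫ x, h.1 x * (diffOp N 1 (Smooth.scale ((m : ℝ) + 1) f)).1 x =
      ∑ p ∈ Finset.HasAntidiagonal.antidiagonal n, ∫ x, (g p.1).1 x *
        (diffOp N (adjointPoly (E p.2)) (Smooth.scale ((m : ℝ) + 1) f)).1 x := by
    intro m
    have hs : HasCompactSupport (Smooth.scale ((m : ℝ) + 1) f).1 :=
      Smooth.hasCompactSupport_scale (by positivity) hf
    simp only [← integral_diffOp_mul _ _ hs]
    rw [← MeasureTheory.integral_finsetSum _ fun p _ => integrable_mul_of_hasCompactSupport _ hs,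
      map_one, Module.End.one_apply, hh, Smooth.coe_sum]
    simp only [Finset.sum_apply, Finset.sum_mul]
  have e2 : ∑ p ∈ Finset.HasAntidiagonal.antidiagonal n,
      MvPolynomial.constantCoeff (adjointPoly (E p.2)) * ∫ x, (g p.1).1 x = ∫ x, (g n).1 x := by
    rw [Finset.sum_eq_single (n, 0)]
    · simp [constantCoeff_adjointPoly, hE]
    · rintro ⟨i, j⟩ hp hne
      have hj : j ≠ 0 := by
        rintro rfl
        simp at hp
        exact hne (by rw [hp])
      simp [constantCoeff_adjointPoly, hE, hj]
    · simp
  simp only [e1] at l1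
  rw [e2] at l2
  simpa using tendsto_nhds_unique l1 l2

end DiffOp

open scoped Convolution

/-! ### Polynomials are dense in the smooth functions -/

section Density

variable {N : ℕ}

theorem continuous_eval (q : MvPolynomial (Fin N) ℝ) :
    Continuous fun x : Fin N → ℝ => MvPolynomial.eval x q :=
  Smooth.continuous (Smooth.ofPoly q)

/-- Weierstrass approximation on balls of `ℝ^N`. -/
theorem exists_eval_near {f : (Fin N → ℝ) → ℝ} (hf : Continuous f) (r : ℝ) {ε : ℝ} (hε : 0 < ε) :
    ∃ q : MvPolynomial (Fin N) ℝ, ∀ x, ‖x‖ ≤ r → |MvPolynomial.eval x q - f x| < ε := by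
  let ev : MvPolynomial (Fin N) ℝ →ₐ[ℝ] C(Fin N → ℝ, ℝ) :=
    MvPolynomial.aeval fun i => ⟨fun x => x i, continuous_apply i⟩
  have hev : ∀ q x, ev q x = MvPolynomial.eval x q := by
    intro q x
    induction q using MvPolynomial.induction_on with
    | C a => simp [ev]
    | add p q hp hq => rw [map_add, map_add, ContinuousMap.add_apply, hp, hq]
    | mul_X p i hp =>
      rw [map_mul, map_mul, ContinuousMap.mul_apply, hp]
      simp [ev]
  have hsep : ev.range.SeparatesPoints := by
    intro x y hxy
    obtain ⟨i, hi⟩ := Function.ne_iff.mp hxy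
    refine ⟨_, ⟨ev (MvPolynomial.X i), ⟨MvPolynomial.X i, rfl⟩, rfl⟩, ?_⟩
    simpa [hev] using hi
  obtain ⟨g, ⟨q, rfl⟩, hg⟩ :=
    ContinuousMap.exists_mem_subalgebra_near_continuous_of_isCompact_of_separatesPoints hsep
      ⟨f, hf⟩ (isCompact_closedBall (0 : Fin N → ℝ) r) hε
  refine ⟨q, fun x hx => ?_⟩
  have h := hg x (by simpa using hx)
  rw [← hev]
  exact h

/-- The convolution of a polynomial with a compactly supported function is a polynomial. -/
theorem exists_eval_eq_integral (q : MvPolynomial (Fin N) ℝ) {k : (Fin N → ℝ) → ℝ}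
    (hk : Continuous k) (hs : HasCompactSupport k) :
    ∃ P : MvPolynomial (Fin N) ℝ, ∀ x,
      MvPolynomial.eval x P = ∫ t, MvPolynomial.eval (x - t) q * k t := by
  have hint : ∀ (q : MvPolynomial (Fin N) ℝ) {k : (Fin N → ℝ) → ℝ}, Continuous k →
      HasCompactSupport k → ∀ x : Fin N → ℝ,
        MeasureTheory.Integrable fun t => MvPolynomial.eval (x - t) q * k t := by
    intro q k hk hs x
    exact (((continuous_eval q).comp (continuous_const.sub continuous_id)).mul
      hk).integrable_of_hasCompactSupport hs.mul_left
  induction q using MvPolynomial.induction_on generalizing k with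
  | C a =>
    refine ⟨MvPolynomial.C (∫ t, a * k t), fun x => ?_⟩
    simp
  | add p q hp hq =>
    obtain ⟨P, hP⟩ := hp hk hs
    obtain ⟨Q, hQ⟩ := hq hk hs
    refine ⟨P + Q, fun x => ?_⟩
    rw [map_add, hP, hQ, ← MeasureTheory.integral_add (hint p hk hs x) (hint q hk hs x)]
    simp only [map_add, add_mul]
  | mul_X p i hp =>
    have hk' : Continuous fun t : Fin N → ℝ => t i * k t := (continuous_apply i).mul hk
    have hs' : HasCompactSupport fun t : Fin N → ℝ => t i * k t := hs.mul_left
    obtain ⟨P, hP⟩ := hp hk hs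
    obtain ⟨Q, hQ⟩ := hp hk' hs'
    -- From `(x - t)_i = x_i - t_i`: the factor `x_i` leaves the integral and `t_i` is absorbed into
    -- the kernel, so the induction must allow every `k`.
    refine ⟨MvPolynomial.X i * P - Q, fun x => ?_⟩
    rw [map_sub, map_mul, MvPolynomial.eval_X, hP, hQ, ← MeasureTheory.integral_const_mul,
      ← MeasureTheory.integral_sub ((hint p hk hs x).const_mul _) (hint p hk' hs' x)]
    refine MeasureTheory.integral_congr_ae (Filter.Eventually.of_forall fun t => ?_)
    simp only [map_mul, MvPolynomial.eval_X, Pi.sub_apply]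
    ring

/-- The derivative falls on the compactly supported factor, so one uniform approximation of `φ`
controls all derivatives of the convolution. -/
theorem partial_coe_eq_convolution {φ : (Fin N → ℝ) → ℝ} (hφ : Continuous φ) {F k : Smooth N}
    (hs : HasCompactSupport k.1)
    (hF : F.1 = (φ ⋆[ContinuousLinearMap.lsmul ℝ ℝ, MeasureTheory.volume] k.1)) (A : Fin N) :
    (Smooth.partial A F).1 =
      (φ ⋆[ContinuousLinearMap.lsmul ℝ ℝ, MeasureTheory.volume] (Smooth.partial A k).1) := by
  funext x
  change fderiv ℝ F.1 x (Pi.single A 1) = _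
  have hk : ContDiff ℝ 1 k.1 := (Smooth.contDiff k).of_le (by simp)
  rw [hF, (hs.hasFDerivAt_convolution_right _ hφ.locallyIntegrable hk x).fderiv,
    MeasureTheory.convolution_precompR_apply _ hφ.locallyIntegrable (hs.fderiv ℝ)
      (hk.continuous_fderiv one_ne_zero)]
  rfl

theorem hasCompactSupport_partials (l : List (Fin N)) {k : Smooth N} (hs : HasCompactSupport k.1) :
    HasCompactSupport (Smooth.partials l k).1 := by
  rw [Smooth.partials_eq_diffOp]
  exact hasCompactSupport_diffOp _ hs

theorem partials_coe_eq_convolution {φ : (Fin N → ℝ) → ℝ} (hφ : Continuous φ) {F k : Smooth N}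
    (hs : HasCompactSupport k.1)
    (hF : F.1 = (φ ⋆[ContinuousLinearMap.lsmul ℝ ℝ, MeasureTheory.volume] k.1))
    (l : List (Fin N)) :
    (Smooth.partials l F).1 =
      (φ ⋆[ContinuousLinearMap.lsmul ℝ ℝ, MeasureTheory.volume] (Smooth.partials l k).1) := by
  induction l with
  | nil => exact hF
  | cons A l ih => exact partial_coe_eq_convolution hφ (hasCompactSupport_partials l hs) ih A

theorem partials_eventuallyEq {f g : Smooth N} {x : Fin N → ℝ} (h : f.1 =ᶠ[nhds x] g.1)
    (l : List (Fin N)) : (Smooth.partials l f).1 =ᶠ[nhds x] (Smooth.partials l g).1 := by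
  induction l with
  | nil => exact h
  | cons A l ih =>
    filter_upwards [ih.fderiv (𝕜 := ℝ)] with y hy
    change fderiv ℝ (Smooth.partials l f).1 y (Pi.single A 1) =
      fderiv ℝ (Smooth.partials l g).1 y (Pi.single A 1)
    rw [hy]

/-- Compactly supported smooth functions are approximated by polynomials in `C^∞`. -/
theorem exists_poly_near_of_hasCompactSupport {k : Smooth N} (hs : HasCompactSupport k.1) {r : ℝ}
    (L : Finset (List (Fin N))) {ε : ℝ} (hε : 0 < ε) :
    ∃ p : MvPolynomial (Fin N) ℝ, ∀ l ∈ L, ∀ x, ‖x‖ ≤ r →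
      |(Smooth.partials l (Smooth.ofPoly p)).1 x - (Smooth.partials l k).1 x| < ε := by
  obtain ⟨δ, hδ, hδL⟩ : ∃ δ > 0, ∀ l ∈ L, ∀ x y, dist x y < δ →
      dist ((Smooth.partials l k).1 x) ((Smooth.partials l k).1 y) < ε / 2 := by
    have h : ∀ l ∈ L, ∀ᶠ e in uniformity (Fin N → ℝ),
        dist ((Smooth.partials l k).1 e.1) ((Smooth.partials l k).1 e.2) < ε / 2 := by
      intro l _
      have hu : UniformContinuous (Smooth.partials l k).1 :=
        (Smooth.continuous _).uniformContinuous_of_tendsto_cocompact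
          (hasCompactSupport_partials l hs).is_zero_at_infty
      exact hu (Metric.dist_mem_uniformity (half_pos hε))
    obtain ⟨δ, hδ, h'⟩ := Metric.mem_uniformity_dist.mp
      ((Filter.eventually_all_finset L).mpr h)
    exact ⟨δ, hδ, fun l hl x y hxy => h' hxy l hl⟩
  -- The mollifier, not `k`, is approximated by a polynomial `q`, and `q ⋆ k` is again a polynomial.
  -- Its derivatives `q ⋆ ∂k` are within `ε / 2` of `φ ⋆ ∂k`, which is within `ε / 2` of `∂k` by the
  -- choice of `δ`.
  let φ : ContDiffBump (0 : Fin N → ℝ) := ⟨δ / 2, δ, half_pos hδ, half_lt_self hδ⟩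
  obtain ⟨S, hS⟩ := hs.isCompact.isBounded.subset_closedBall 0
  set M : ℝ := 1 + ∑ l ∈ L, ∫ t, |(Smooth.partials l k).1 t| with hM
  have hM0 : 0 < M := by
    have : 0 ≤ ∑ l ∈ L, ∫ t, |(Smooth.partials l k).1 t| :=
      Finset.sum_nonneg fun l _ => MeasureTheory.integral_nonneg fun t => abs_nonneg _
    linarith
  have hφc : Continuous (φ.normed MeasureTheory.volume) := φ.continuous_normed
  -- The ball of radius `r + S` contains every `x - t` with `‖x‖ ≤ r` and `t` in the support of `k`;
  -- `M` exceeds the `L¹` norm of each derivative in question.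
  obtain ⟨q, hq⟩ := exists_eval_near hφc (r + S) (ε := ε / 2 / M) (by positivity)
  obtain ⟨p, hp⟩ := exists_eval_eq_integral q (Smooth.continuous k) hs
  refine ⟨p, fun l hl x hx => ?_⟩
  have hpl := partials_coe_eq_convolution (continuous_eval q) (F := Smooth.ofPoly p) hs
    (by
      funext x
      rw [MeasureTheory.convolution_lsmul_swap]
      exact hp x) l
  set g := Smooth.partials l k with hg
  have hgs : HasCompactSupport g.1 := hasCompactSupport_partials l hs
  have hgS : ∀ t, S < ‖t‖ → g.1 t = 0 := by
    intro t ht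
    have ht' : t ∉ tsupport k.1 := fun h => by
      have := hS h
      rw [mem_closedBall_zero_iff] at this
      linarith
    have h0 : k.1 =ᶠ[nhds t] (0 : Smooth N).1 := notMem_tsupport_iff_eventuallyEq.mp ht'
    have h1 := (partials_eventuallyEq h0 l).eq_of_nhds
    rw [hg, h1, Smooth.partials_eq_diffOp, map_zero]
    rfl
  have hgi : MeasureTheory.Integrable fun t => |g.1 t| :=
    ((Smooth.continuous g).integrable_of_hasCompactSupport hgs).norm
  have e1 : |(φ.normed MeasureTheory.volume
      ⋆[ContinuousLinearMap.lsmul ℝ ℝ, MeasureTheory.volume] g.1) x - g.1 x| ≤ ε / 2 :=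
    φ.dist_normed_convolution_le (Smooth.continuous g).aestronglyMeasurable
      fun y hy => (hδL l hl y x hy).le
  have e2 : |((fun y => MvPolynomial.eval y q)
      ⋆[ContinuousLinearMap.lsmul ℝ ℝ, MeasureTheory.volume] g.1) x -
      (φ.normed MeasureTheory.volume
        ⋆[ContinuousLinearMap.lsmul ℝ ℝ, MeasureTheory.volume] g.1) x| < ε / 2 := by
    have hc : ∀ {u : (Fin N → ℝ) → ℝ}, Continuous u →
        MeasureTheory.Integrable fun t => u (x - t) • g.1 t := by
      intro u hu
      exact ((hu.comp (continuous_const.sub continuous_id)).mul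
        (Smooth.continuous g)).integrable_of_hasCompactSupport hgs.mul_left
    rw [MeasureTheory.convolution_lsmul_swap, MeasureTheory.convolution_lsmul_swap,
      ← MeasureTheory.integral_sub (hc (continuous_eval q)) (hc hφc)]
    calc |∫ t, (MvPolynomial.eval (x - t) q • g.1 t -
          φ.normed MeasureTheory.volume (x - t) • g.1 t)|
        ≤ ∫ t, ε / 2 / M * |g.1 t| := by
          rw [← Real.norm_eq_abs]
          refine MeasureTheory.norm_integral_le_of_norm_le (hgi.const_mul _)
            (Filter.Eventually.of_forall fun t => ?_)
          rw [← sub_smul, norm_smul, Real.norm_eq_abs, Real.norm_eq_abs]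
          by_cases ht : S < ‖t‖
          · simp [hgS t ht]
          · refine mul_le_mul_of_nonneg_right (hq _ ?_).le (abs_nonneg _)
            exact (norm_sub_le x t).trans (add_le_add hx (not_lt.mp ht))
      _ = ε / 2 / M * ∫ t, |g.1 t| := MeasureTheory.integral_const_mul _ _
      _ < ε / 2 / M * M := by
          refine mul_lt_mul_of_pos_left ?_ (by positivity)
          have := Finset.single_le_sum (f := fun l => ∫ t, |(Smooth.partials l k).1 t|)
            (fun l _ => MeasureTheory.integral_nonneg fun t => abs_nonneg _) hl
          simp only [← hg] at this
          linarith
      _ = ε / 2 := div_mul_cancel₀ _ hM0.ne'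
  rw [hpl]
  calc _ ≤ _ := abs_sub_le _ ((φ.normed MeasureTheory.volume
        ⋆[ContinuousLinearMap.lsmul ℝ ℝ, MeasureTheory.volume] g.1) x) _
    _ < ε / 2 + ε / 2 := add_lt_add_of_lt_of_le e2 e1
    _ = ε := add_halves ε

theorem exists_poly_near (f : Smooth N) {r : ℝ} (hr : 0 ≤ r) (L : Finset (List (Fin N))) {ε : ℝ}
    (hε : 0 < ε) :
    ∃ p : MvPolynomial (Fin N) ℝ, ∀ l ∈ L, ∀ x, ‖x‖ ≤ r →
      |(Smooth.partials l (Smooth.ofPoly p)).1 x - (Smooth.partials l f).1 x| < ε := by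
  -- The margin `1` makes `χ * f` and `f` agree near every point of the ball of radius `r`, so their
  -- derivatives agree there too.
  obtain ⟨χ, hχ, hχ1⟩ := exists_cutoff N (r + 1) (by linarith)
  obtain ⟨p, hp⟩ := exists_poly_near_of_hasCompactSupport (k := χ * f) (r := r) hχ.mul_right L hε
  refine ⟨p, fun l hl x hx => ?_⟩
  have h : (χ * f).1 =ᶠ[nhds x] f.1 := by
    have hx' : x ∈ Metric.ball (0 : Fin N → ℝ) (r + 1) := by
      rw [mem_ball_zero_iff]
      linarith
    filter_upwards [Metric.isOpen_ball.mem_nhds hx'] with y hy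
    rw [mem_ball_zero_iff] at hy
    change χ.1 y * f.1 y = f.1 y
    rw [hχ1 y hy.le, one_mul]
  rw [← (partials_eventuallyEq h l).eq_of_nhds]
  exact hp l hl x hx

/-- Every smooth function is the limit of a sequence of polynomials in `C^∞`. -/
theorem exists_poly_converges (f : Smooth N) :
    ∃ p : ℕ → MvPolynomial (Fin N) ℝ, Smooth.Converges (fun m => Smooth.ofPoly (p m)) f := by
  -- Order of differentiation, radius and accuracy are all tied to `m`; only finitely many
  -- derivatives are involved at each stage.
  have h : ∀ m : ℕ, ∃ p : MvPolynomial (Fin N) ℝ, ∀ l : List (Fin N), l.length ≤ m →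
      ∀ x, ‖x‖ ≤ m →
        |(Smooth.partials l (Smooth.ofPoly p)).1 x - (Smooth.partials l f).1 x| <
          1 / ((m : ℝ) + 1) := by
    intro m
    obtain ⟨p, hp⟩ := exists_poly_near f (r := m) m.cast_nonneg
      (List.finite_length_le (Fin N) m).toFinset (ε := 1 / ((m : ℝ) + 1)) (by positivity)
    exact ⟨p, fun l hl => hp l (by simpa using hl)⟩
  choose p hp using h
  refine ⟨p, fun l K hK => Metric.tendstoUniformlyOn_iff.mpr fun ε hε => ?_⟩
  obtain ⟨S, hS⟩ := hK.isBounded.subset_closedBall 0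
  filter_upwards [Filter.eventually_ge_atTop l.length, Filter.eventually_ge_atTop ⌈S⌉₊,
    (tendsto_one_div_add_atTop_nhds_zero_nat (𝕜 := ℝ)).eventually (gt_mem_nhds hε)]
    with m h1 h2 h3 x hx
  rw [dist_comm, Real.dist_eq]
  refine (hp m l h1 x ?_).trans h3
  have := hS hx
  rw [mem_closedBall_zero_iff] at this
  exact this.trans ((Nat.le_ceil S).trans (by exact_mod_cast h2))

end Density

/-! ### The quantum polynomials are dense -/

section Hat

variable {N : ℕ} {𝔤 : Type*} [LieRing 𝔤] [LieAlgebra ℝ 𝔤] {b : Module.Basis (Fin N) ℝ 𝔤}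

/-- The ordered polynomials in the `ẑ_A`. -/
noncomputable def hatOrdered (b : Module.Basis (Fin N) ℝ 𝔤) :
    MvPolynomial (Fin N) ℝ →ₗ[ℝ] HatPoly b :=
  (MvPolynomial.basisMonomials (Fin N) ℝ).constr ℝ fun α =>
    ((List.finRange N).map fun A => HatPoly.z b A ^ α A).prod

theorem constantCoeff_vectorField (Φ : LeftInvariantFrame b) (A : Fin N) :
    PowerSeries.constantCoeff (vectorField (Φ.ψ A)) = zz A := by
  rw [← PowerSeries.coeff_zero_eq_constantCoeff_apply, coeff_vectorField,
    Finset.sum_eq_single A]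
  · rw [PowerSeries.coeff_zero_eq_constantCoeff_apply, Φ.at_lam_zero, if_pos rfl, map_one, one_mul]
  · intro B _ hB
    rw [PowerSeries.coeff_zero_eq_constantCoeff_apply, Φ.at_lam_zero, if_neg (Ne.symm hB), map_zero,
      zero_mul]
  · simp

/-- At `λ = 0` each `Z_A` reduces to `z_A`, so `Ω` on ordered polynomials is the identity to leading
order. -/
theorem constantCoeff_substZ_hatOrdered (Φ : LeftInvariantFrame b) (p : MvPolynomial (Fin N) ℝ) :
    PowerSeries.constantCoeff (substZ Φ (hatOrdered b p)) = zPoly N p := by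
  induction p using MvPolynomial.induction_on' with
  | monomial α a =>
    have h1 : MvPolynomial.monomial α a = a • MvPolynomial.basisMonomials (Fin N) ℝ α := by
      simp [MvPolynomial.smul_monomial]
    rw [h1, map_smul, map_smul, ← PowerSeries.coeff_zero_eq_constantCoeff_apply,
      PowerSeries.coeff_smul, map_smul, PowerSeries.coeff_zero_eq_constantCoeff_apply, hatOrdered, zPoly,
      Module.Basis.constr_basis, Module.Basis.constr_basis, map_list_prod, map_list_prod,
      List.map_map, List.map_map]
    congr 3
    funext A
    simp [substZ_z, constantCoeff_vectorField]
  | add p q hp hq => simp only [map_add, hp, hq]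

theorem OmegaPoly_add (Φ : LeftInvariantFrame b) (u v : HatPoly b) :
    OmegaPoly Φ (u + v) = OmegaPoly Φ u + OmegaPoly Φ v := by
  ext1 n
  simp only [OmegaPoly, map_add, PowerSeries.coeff_mk, omega, MulOpposite.unop_add,
    LinearMap.add_apply]

theorem OmegaPoly_lam_mul (Φ : LeftInvariantFrame b) (u : HatPoly b) :
    OmegaPoly Φ (HatPoly.lam b * u) = PowerSeries.X * OmegaPoly Φ u := by
  ext1 n
  rw [OmegaPoly, PowerSeries.coeff_mk, map_mul, substZ_lam]
  rcases n with _ | n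
  · rw [PowerSeries.coeff_zero_X_mul, PowerSeries.coeff_zero_X_mul, omega, map_zero]
    rfl
  · rw [PowerSeries.coeff_succ_X_mul, PowerSeries.coeff_succ_X_mul, OmegaPoly, PowerSeries.coeff_mk]

theorem coeff_zero_OmegaPoly_hatOrdered (Φ : LeftInvariantFrame b) (p : MvPolynomial (Fin N) ℝ) :
    PowerSeries.coeff 0 (OmegaPoly Φ (hatOrdered b p)) = p := by
  rw [OmegaPoly, PowerSeries.coeff_mk, PowerSeries.coeff_zero_eq_constantCoeff_apply,
    constantCoeff_substZ_hatOrdered, omega_zPoly]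

/-- `Ω` is surjective modulo `λ^n`. -/
theorem exists_coeff_OmegaPoly_eq (Φ : LeftInvariantFrame b) (n : ℕ)
    (p : PowerSeries (MvPolynomial (Fin N) ℝ)) :
    ∃ u : HatPoly b, ∀ k < n, PowerSeries.coeff k (OmegaPoly Φ u) = PowerSeries.coeff k p := by
  induction n generalizing p with
  | zero => exact ⟨0, fun k hk => absurd hk (Nat.not_lt_zero k)⟩
  | succ n ih =>
    -- `v` matches the `λ^0` coefficient; the remaining error is divisible by `λ`, and its quotient
    -- is handled by induction.
    set v := hatOrdered b (PowerSeries.coeff 0 p) with hv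
    obtain ⟨u, hu⟩ := ih (PowerSeries.mk fun k =>
      PowerSeries.coeff (k + 1) p - PowerSeries.coeff (k + 1) (OmegaPoly Φ v))
    refine ⟨v + HatPoly.lam b * u, fun k hk => ?_⟩
    rw [OmegaPoly_add, OmegaPoly_lam_mul, map_add]
    rcases k with _ | k
    · rw [PowerSeries.coeff_zero_X_mul, add_zero, hv, coeff_zero_OmegaPoly_hatOrdered]
    · rw [PowerSeries.coeff_succ_X_mul, hu k (Nat.lt_of_succ_lt_succ hk), PowerSeries.coeff_mk,
        add_sub_cancel]

/-- A diagonal choice: `u m` reproduces the `m`-th approximants of the first `m` coefficients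
exactly, so each fixed coefficient eventually follows its own approximating sequence. -/
theorem exists_ofPoly_converges {Φ : LeftInvariantFrame b} (f : Hat Φ) :
    ∃ u : ℕ → HatPoly b, Hat.Converges (fun m => Hat.ofPoly Φ (u m)) f := by
  choose p hp using fun n => exists_poly_converges (PowerSeries.coeff n f.Omega)
  choose u hu using fun m : ℕ => exists_coeff_OmegaPoly_eq Φ m (PowerSeries.mk fun n => p n m)
  refine ⟨u, fun n l K hK => (hp n l K hK).congr ?_⟩
  filter_upwards [Filter.eventually_gt_atTop n] with m hm x _
  simp only [Hat.ofPoly, PowerSeries.coeff_mk, hu m n hm]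

/-! ### The translation -/

variable {Φ : LeftInvariantFrame b}

/-- The map `f̂(ẑ) ↦ f̂(ẑ + λ c)`, as the differential operator `E(∂/∂z)` on `Ω(f̂)`. -/
noncomputable def translate (f : Hat Φ) : Hat Φ where
  Omega := PowerSeries.mk fun n => ∑ p ∈ Finset.HasAntidiagonal.antidiagonal n,
    diffOp N (PowerSeries.coeff p.2 Φ.modular) (PowerSeries.coeff p.1 f.Omega)

theorem coeff_Omega_translate (f : Hat Φ) (n : ℕ) :
    PowerSeries.coeff n (translate f).Omega = ∑ p ∈ Finset.HasAntidiagonal.antidiagonal n,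
      diffOp N (PowerSeries.coeff p.2 Φ.modular) (PowerSeries.coeff p.1 f.Omega) :=
  PowerSeries.coeff_mk n fun n => ∑ p ∈ Finset.HasAntidiagonal.antidiagonal n,
    diffOp N (PowerSeries.coeff p.2 Φ.modular) (PowerSeries.coeff p.1 f.Omega)

theorem Hat.ext_coeff {f g : Hat Φ}
    (h : ∀ n, PowerSeries.coeff n f.Omega = PowerSeries.coeff n g.Omega) : f = g := by
  cases f
  cases g
  congr 1
  exact PowerSeries.ext h

theorem translate_ofPoly (u : HatPoly b) :
    translate (Hat.ofPoly Φ u) = Hat.ofPoly Φ (hatShift b u) := by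
  refine Hat.ext_coeff fun n => ?_
  rw [coeff_Omega_translate]
  simp only [Hat.ofPoly, PowerSeries.coeff_mk, coeff_OmegaPoly_hatShift, Smooth.ofPoly_sum,
    diffOp_ofPoly]

theorem isCNumberTranslation_translate :
    IsCNumberTranslation (translate : Hat Φ → Hat Φ) where
  on_poly := translate_ofPoly
  continuous u f h n := by
    simp only [coeff_Omega_translate]
    exact Smooth.Converges.sum _ fun p _ => (h p.1).diffOp _

theorem IsCNumberTranslation.unique {T T' : Hat Φ → Hat Φ} (hT : IsCNumberTranslation T)
    (hT' : IsCNumberTranslation T') : T' = T := by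
  funext f
  obtain ⟨u, hu⟩ := exists_ofPoly_converges f
  refine Hat.ext_coeff fun n => ?_
  have h1 := hT.continuous _ _ hu n
  have h2 := hT'.continuous _ _ hu n
  simp only [hT.on_poly] at h1
  simp only [hT'.on_poly] at h2
  exact h2.unique h1

theorem integralExists_translate {g : Hat Φ} (hg : g.DerivativesIntegrable) :
    (translate g).IntegralExists := by
  intro n
  rw [coeff_Omega_translate]
  exact integrable_coe_sum _ fun p _ => integrable_diffOp _ (hg p.1)

theorem integral_translate {g : Hat Φ} (hg : g.IntegralExists)
    (hT : (translate g).IntegralExists) : (translate g).integral = g.integral := by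
  ext1 n
  rw [Hat.integral, Hat.integral, PowerSeries.coeff_mk, PowerSeries.coeff_mk]
  exact integral_sum_diffOp (fun n => PowerSeries.coeff n Φ.modular)
    Φ.constantCoeff_coeff_modular hg (coeff_Omega_translate g n) (hT n)

end Hat

end LieStar

theorem mainTheorem7 {N : ℕ} {𝔤 : Type*} [LieRing 𝔤] [LieAlgebra ℝ 𝔤]
    (b : Module.Basis (Fin N) ℝ 𝔤) (Φ : LieStar.LeftInvariantFrame b) :
    ∃ T : LieStar.Hat Φ → LieStar.Hat Φ,
      (LieStar.IsCNumberTranslation T ∧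
        ∀ T' : LieStar.Hat Φ → LieStar.Hat Φ, LieStar.IsCNumberTranslation T' → T' = T) ∧
      (∀ g : LieStar.Hat Φ, g.DerivativesIntegrable → (T g).IntegralExists) ∧
      (∀ g : LieStar.Hat Φ, g.IntegralExists → (T g).IntegralExists →
        (T g).integral = g.integral) :=
  ⟨LieStar.translate,
    ⟨LieStar.isCNumberTranslation_translate,
      fun _ => LieStar.isCNumberTranslation_translate.unique⟩,
    fun _ => LieStar.integralExists_translate, fun _ => LieStar.integral_translate⟩
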